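/- **Setting.** Let a seed CFT $\mathcal C$ of central charge $c$ be given by its bulk state space: an orthonormal basis $S$ of joint $L_0,\bar L_0$-eigenstates of weights $(h_s,\bar h_s)$ with integer spin $h_s-\bar h_s$, and two commuting unitary actions $L_n,\bar L_n$ ($n\in\mathbb Z$, $L_n^\dagger=L_{-n}$, $\bar L_n^\dagger=\bar L_{-n}$) of the Virasoro algebra of central charge $c$. Boundary states are formal (not necessarily normalizable) combinations of basis states. A family $(x_i)$ of formal states in a theory of central charge $C$ *satisfies Cardy's condition* if for all $i,j$ and all $\tau$ in the upper half plane, with $q=e^{2\pi i\tau}$, $\tilde q=e^{-2\pi i/\tau}$, the overlap converges and $$\langle x_i|\tilde q^{\frac12(L_0+\bar L_0-\frac{C}{12})}|x_j\rangle=\sum_{h\ge 0}m_{ij}(h)\,q^{h-\frac{C}{24}},\qquad m_{ij}(h)\in\mathbb Z_{\ge0},\quad m_{ij}(0)=\delta_{ij},$$ with $m_{ij}$ independent of $\tau$. Let $(|a_i\rangle)_{i\in B}$ be seed boundary states, indexed by a totally ordered, possibly infinite, set $B$, that satisfy $(L_n-\bar L_{-n})|a_i\rangle=0$ for all $n\in\mathbb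 Z$ and Cardy's condition with $C=c$. **Symmetric orbifold.** Let $N\ge 0$. In the sector of $\mathcal C^{\otimes N}$ twisted by $g\in S_N$ there is one copy of the seed state space for every cycle of $g$ (fixed points included); on the factor of a cycle of length $k$ the fractional modes are $L_{m/k}=\frac1kL_m+\frac c{24}(k-\frac1k)\delta_{m,0}$, and likewise for $\bar L$. States of $\mathcal C^{\otimes N}/S_N$ are the $S_N$-invariant formal elements of the direct sum of these sectors, where $u\in S_N$ maps the $g$-sector to the $ugu^{-1}$-sector and a rotation of a $k$-cycle by $j$ steps acts by $e^{2\pi i j(h-\bar h)/k}$. The *symmetry class* is the space of orbifold states annihilated by $L_n-\bar L_{-n}$ for all $n\in\frac1k\mathbb Z$, on every cycle of length $k$ (in particular on every untwisted copy), in every sector. For a seed state $|a\rangle$ and a cycle $\sigma$, $|a_\sigma\rangle$ is the state with the same coefficients on the factor of $\sigma$; if $g$ has disjoint cycles $\sigma_1,\dots,\sigma_m$, then $|a_g\rangle=|a_{\sigma_1}\rangle\otimes\cdots\otimes|a_{\sigma_m}\rangle$. For $\vec n=(n_i)_{i\in B}$ with $\sum_in_i=N$, let $S_{n_i}(N_i)$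 be the group of permutations of the copies $N_i+1,\dots,N_i+n_i$, where $N_i=\sum_{j<i}n_j$. For $\vec r=(r_i)$ with $r_i$ an isomorphism class of irreducible complex representations of $S_{n_i}$, and $\vec\kappa=(\kappa_i)$ with $\kappa_i$ a conjugacy class of $S_{n_i}$, put $$|\vec n,\vec r\rangle=\frac1{\sqrt{N!}}\sum_{h\in S_N}\prod_i\Bigl(\sum_{g_i\in S_{n_i}(N_i)}\frac{\chi^{r_i}(g_i)}{n_i!}\,|(a_i)_{hg_ih^{-1}}\rangle\Bigr),\qquad |\vec n,\vec\kappa\rangle\rangle=\sum_{h\in S_N}\prod_i\Bigl(\sum_{g_i\in\kappa_i}|(a_i)_{hg_ih^{-1}}\rangle\Bigr).$$ Call a family *complete in* a space $V$ of states if it is a basis of $V$ and no set of states in $V$ that satisfies Cardy's condition properly contains it. **Claim.** 1. Every $|\vec n,\vec r\rangle$ is an orbifold state in the symmetry class. 2. The family of all $|\vec n,\vec r\rangle$ satisfies Cardy's condition with $C=Nc$: all overlaps are open-string partition functions with non-negative integer multiplicities, and the vacuum occurs exactly once if $(\vec n,\vec r)=(\vec n',\vec r')$ and not at all otherwise. 3.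 For every $\vec n$ the sets of all $\vec r$ and of all $\vec\kappa$ are in bijection, and the states $|\vec n,\vec r\rangle$ span the same space as the Ishibashi states $|\vec n,\vec\kappa\rangle\rangle$. All the $|\vec n,\vec\kappa\rangle\rangle$ are linearly independent states of the symmetry class, and the family of all $|\vec n,\vec r\rangle$ is complete in their span. 4. Suppose that the seed boundary states are complete, in the sense that their span is dense (coefficientwise) in the space of all formal seed states with $(L_n-\bar L_{-n})|x\rangle=0$ for all $n\in\mathbb Z$. Then the span of all $|\vec n,\vec r\rangle$ is dense (coefficientwise) in the symmetry class; and if $B$ is finite, the family of all $|\vec n,\vec r\rangle$ is complete in the symmetry class. -/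

import Mathlib

open scoped BigOperators ComplexConjugate

noncomputable section

namespace SymOrb

/-! ### The seed theory -/

/-- The bulk state space of a unitary two-dimensional CFT with discrete spectrum, presented in an
orthonormal basis `S` of joint `L₀`, `L̄₀` eigenstates: the (algebraic) state space is `S →₀ ℂ`,
`hol` and `ahol` are the weights, and `L n`, `Lbar n` are two commuting unitary actions of the
Virasoro algebra of central charge `c`.  The further axioms of a CFT (operator products, crossing,
modular invariance, uniqueness of the bulk vacuum, ...) are not imposed. -/
structure SeedCFT (S : Type*) where
  /-- central charge -/
  c : ℝ
  /-- holomorphic weight of a basis state -/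
  hol : S → ℝ
  /-- antiholomorphic weight of a basis state -/
  ahol : S → ℝ
  /-- holomorphic Virasoro modes -/
  L : ℤ → Module.End ℂ (S →₀ ℂ)
  /-- antiholomorphic Virasoro modes -/
  Lbar : ℤ → Module.End ℂ (S →₀ ℂ)
  virasoro : ∀ m n : ℤ, L m * L n - L n * L m =
    ((m : ℂ) - n) • L (m + n) +
      (if m + n = 0 then (c : ℂ) / 12 * ((m : ℂ) ^ 3 - m) else 0) • (1 : Module.End ℂ (S →₀ ℂ))
  virasoro_bar : ∀ m n : ℤ, Lbar m * Lbar n - Lbar n * Lbar m =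
    ((m : ℂ) - n) • Lbar (m + n) +
      (if m + n = 0 then (c : ℂ) / 12 * ((m : ℂ) ^ 3 - m) else 0) • (1 : Module.End ℂ (S →₀ ℂ))
  commute : ∀ m n : ℤ, L m * Lbar n = Lbar n * L m
  L_zero : ∀ s, L 0 (Finsupp.single s 1) = Finsupp.single s (hol s : ℂ)
  Lbar_zero : ∀ s, Lbar 0 (Finsupp.single s 1) = Finsupp.single s (ahol s : ℂ)
  /-- `L n` and `L (-n)` are adjoint -/
  adjoint : ∀ (n : ℤ) (s t : S),
    L n (Finsupp.single t 1) s = conj (L (-n) (Finsupp.single s 1) t)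
  adjoint_bar : ∀ (n : ℤ) (s t : S),
    Lbar n (Finsupp.single t 1) s = conj (Lbar (-n) (Finsupp.single s 1) t)
  /-- spins are integers -/
  spin_int : ∀ s, ∃ k : ℤ, hol s - ahol s = k

/-- The action of the mode `A n` on formal (not necessarily normalizable) states, that is, on
arbitrary functions `S → ℂ` of coefficients, for a family of modes with `(A n)† = A (-n)`:
`(A n x) s = ⟨A (-n) s | x⟩ = ∑ t, ⟨s| A n |t⟩ x t`, which is a finite sum. -/
def formalMode {S : Type*} (A : ℤ → Module.End ℂ (S →₀ ℂ)) (n : ℤ) :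
    (S → ℂ) →ₗ[ℂ] (S → ℂ) where
  toFun x s := (A (-n) (Finsupp.single s 1)).sum fun t z => conj z * x t
  map_add' x y := by
    funext s; simp [Finsupp.sum, mul_add, Finset.sum_add_distrib]
  map_smul' r x := by
    funext s; simp [Finsupp.sum, Finset.mul_sum, mul_left_comm]

/-- The space of formal states of the seed theory with `L n |x⟩ = L̄ (-n) |x⟩` for all `n`. -/
def SeedCFT.ishibashiSpace {S : Type*} (T : SeedCFT S) : Submodule ℂ (S → ℂ) :=
  ⨅ n : ℤ, LinearMap.eqLocus (formalMode T.L n) (formalMode T.Lbar (-n))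

/-- Total scaling dimension of a basis state of the seed theory. -/
def SeedCFT.dim {S : Type*} (T : SeedCFT S) (s : S) : ℝ := T.hol s + T.ahol s

/-! ### Cardy's consistency condition -/

/-- Let `σ` label an orthonormal basis of states of scaling dimensions `dim`, in a theory of central
charge `C`.  The cylinder amplitude `⟨x| q̃ ^ ((L₀ + L̄₀ - C/12)/2) |y⟩`, `q̃ = exp (-2πi/τ)`,
converges and is an open-string partition function `∑ h, m h * q ^ (h - C/24)`, `q = exp (2πiτ)`,
with multiplicities `m h` that are natural numbers, with no states below the vacuum `h = 0`,
and with the vacuum occurring exactly `v` times. -/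
def IsOpenStringAmplitude {σ : Type*} (C : ℝ) (dim : σ → ℝ) (x y : σ → ℂ) (v : ℕ) : Prop :=
  ∃ m : ℝ → ℕ, (∀ h < 0, m h = 0) ∧ m 0 = v ∧
    ∀ τ : UpperHalfPlane, ∃ Z : ℂ,
      HasSum (fun b => conj (x b) * y b *
        Complex.exp (-(2 * Real.pi * Complex.I / (τ : ℂ)) *
          (((dim b : ℂ) - (C : ℂ) / 12) / 2))) Z ∧
      HasSum (fun h : ℝ => (m h : ℂ) *
        Complex.exp (2 * Real.pi * Complex.I * (τ : ℂ) * ((h : ℂ) - (C : ℂ) / 24))) Z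

open Classical in
/-- Cardy's condition for a family of boundary states: every overlap is an open-string partition
function, in which the vacuum occurs once if the two labels agree, and not at all otherwise. -/
def IsCardyFamily {σ ι : Type*} (C : ℝ) (dim : σ → ℝ) (x : ι → σ → ℂ) : Prop :=
  ∀ i j, IsOpenStringAmplitude C dim (x i) (x j) (if i = j then 1 else 0)

/-- The family `x` of boundary states is a complete set within the space `V` of states: it is a
basis of `V`, and it is maximal, that is, no set of states in `V` that satisfies Cardy's condition
properly contains it. -/
def IsCompleteIn {σ ι : Type*} (C : ℝ) (dim : σ → ℝ) (x : ι → σ → ℂ)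
    (V : Submodule ℂ (σ → ℂ)) : Prop :=
  LinearIndependent ℂ x ∧ Submodule.span ℂ (Set.range x) = V ∧
    ∀ X : Set (σ → ℂ), Set.range x ⊆ X → X ⊆ V →
      IsCardyFamily C dim (fun y : X => (y : σ → ℂ)) → X = Set.range x

/-! ### Twisted sectors -/

/-- The cycles of a permutation, fixed points included. -/
def Cycles {N : ℕ} (p : Equiv.Perm (Fin N)) : Type :=
  Quotient (Equiv.Perm.SameCycle.setoid p)

instance {N : ℕ} (p : Equiv.Perm (Fin N)) : Finite (Cycles p) :=
  inferInstanceAs (Finite (Quotient _))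

instance {N : ℕ} (p : Equiv.Perm (Fin N)) : Fintype (Cycles p) := Fintype.ofFinite _

instance {N : ℕ} (p : Equiv.Perm (Fin N)) : DecidableEq (Cycles p) := Classical.decEq _

/-- The cycle through a given copy. -/
def Cycles.of {N : ℕ} (p : Equiv.Perm (Fin N)) (k : Fin N) : Cycles p :=
  Quotient.mk (Equiv.Perm.SameCycle.setoid p) k

/-- A chosen first copy of a cycle. -/
def Cycles.base {N : ℕ} {p : Equiv.Perm (Fin N)} (c : Cycles p) : Fin N :=
  Quotient.out (s := Equiv.Perm.SameCycle.setoid p) c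

/-- The length of a cycle. -/
def Cycles.len {N : ℕ} {p : Equiv.Perm (Fin N)} (c : Cycles p) : ℕ :=
  Nat.card {k : Fin N // Cycles.of p k = c}

/-- Basis states of all the sectors of `C^{⊗N}` twisted by permutations.  In the sector twisted by
`p` the copies in a cycle of length `k` are glued into one copy of the seed theory that lives on the
`k`-fold cover of the circle, so a basis state is a choice of a basis state of the seed theory for
every cycle.  On the factor of a cycle of length `k`, the Virasoro modes on the `k`-fold cover give
the fractional modes `L_{m/k} = (1/k) L_m + (c/24) (k - 1/k) δ_{m,0}`. -/
abbrev OrbBasis (S : Type*) (N : ℕ) : Type _ := Σ p : Equiv.Perm (Fin N), Cycles p → S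

/-- The operator `A` acting on the factor `c` of a tensor product over `ι`. -/
def slot {ι S : Type*} [DecidableEq ι] (A : (S → ℂ) →ₗ[ℂ] (S → ℂ)) (c : ι) :
    ((ι → S) → ℂ) →ₗ[ℂ] ((ι → S) → ℂ) where
  toFun x s := A (fun t => x (Function.update s c t)) (s c)
  map_add' x y := by
    funext s
    exact congrFun (A.map_add (fun t => x (Function.update s c t))
      (fun t => y (Function.update s c t))) (s c)
  map_smul' r x := by
    funext s
    exact congrFun (A.map_smul r (fun t => x (Function.update s c t))) (s c)

/-- The fractional mode of index `m / k` on the cycle `c` (of length `k`) in the sector twisted by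
`p`, where `A` is the family of Virasoro modes of the seed theory (of central charge `C`). -/
def fracMode {N : ℕ} {S : Type*} (C : ℝ) (A : ℤ → Module.End ℂ (S →₀ ℂ))
    {p : Equiv.Perm (Fin N)} (c : Cycles p) (m : ℤ) :
    ((Cycles p → S) → ℂ) →ₗ[ℂ] ((Cycles p → S) → ℂ) :=
  (1 / (c.len : ℂ)) • slot (formalMode A m) c +
    (if m = 0 then (C : ℂ) / 24 * ((c.len : ℂ) - 1 / (c.len : ℂ)) else 0) • LinearMap.id

/-- The weight (the `L₀` eigenvalue) of a basis state of a twisted sector, computed from the weights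
`w` of the seed theory: a cycle of length `k` contributes `w/k + (c/24) (k - 1/k)`. -/
def orbWeight {N : ℕ} {S : Type*} (C : ℝ) (w : S → ℝ) (b : OrbBasis S N) : ℝ :=
  ∑ c : Cycles b.1, (w (b.2 c) / (c.len : ℝ) + C / 24 * ((c.len : ℝ) - 1 / (c.len : ℝ)))

/-- Total scaling dimension of a basis state of a twisted sector. -/
def SeedCFT.orbDim {S : Type*} (T : SeedCFT S) (N : ℕ) (b : OrbBasis S N) : ℝ :=
  orbWeight T.c T.hol b + orbWeight T.c T.ahol b

/-! ### The action of the symmetric group and the symmetry class -/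

/-- A permutation `u` of the copies maps the cycles of `u⁻¹ p u` to the cycles of `p`. -/
def cycleMap {N : ℕ} (u p : Equiv.Perm (Fin N)) (c : Cycles (u⁻¹ * p * u)) : Cycles p :=
  Quotient.map' (s₁ := Equiv.Perm.SameCycle.setoid (u⁻¹ * p * u))
    (s₂ := Equiv.Perm.SameCycle.setoid p) u
    (fun a b hab => by
      have h : Equiv.Perm.SameCycle (u⁻¹ * p * u⁻¹⁻¹) a b := by rw [inv_inv]; exact hab
      have h2 := Equiv.Perm.sameCycle_conj.mp h
      rw [inv_inv] at h2
      exact h2) c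

theorem exists_turn {N : ℕ} (u p : Equiv.Perm (Fin N)) (c : Cycles (u⁻¹ * p * u)) :
    ∃ j : ℤ, (p ^ j) (cycleMap u p c).base = u c.base := by
  have h1 : cycleMap u p c = Cycles.of p (u c.base) := by
    conv_lhs => rw [← Quotient.out_eq (s := Equiv.Perm.SameCycle.setoid (u⁻¹ * p * u)) c]
    rfl
  have h2 : Cycles.of p (cycleMap u p c).base = Cycles.of p (u c.base) := by
    rw [← h1]
    exact Quotient.out_eq (s := Equiv.Perm.SameCycle.setoid p) _
  exact Quotient.exact (s := Equiv.Perm.SameCycle.setoid p) h2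

/-- The number of steps along the cycle by which `u` displaces the chosen first copies. -/
def turn {N : ℕ} (u p : Equiv.Perm (Fin N)) (c : Cycles (u⁻¹ * p * u)) : ℤ :=
  (exists_turn u p c).choose

/-- The action of a permutation `u` of the copies on (formal) states.  It maps the sector twisted by
`u⁻¹ p u` to the sector twisted by `p` and permutes the factors; a rotation of a cycle of length `k`
by `j` steps acts by `exp (2πi j (h - h̄) / k)`. -/
def SeedCFT.permAct {S : Type*} (T : SeedCFT S) {N : ℕ} (u : Equiv.Perm (Fin N)) :
    (OrbBasis S N → ℂ) →ₗ[ℂ] (OrbBasis S N → ℂ) where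
  toFun x b :=
    (∏ c : Cycles (u⁻¹ * b.1 * u), Complex.exp (2 * Real.pi * Complex.I *
      ((turn u b.1 c : ℂ) * ((T.hol (b.2 (cycleMap u b.1 c)) : ℂ) -
        (T.ahol (b.2 (cycleMap u b.1 c)) : ℂ)) / (c.len : ℂ)))) *
    x ⟨u⁻¹ * b.1 * u, fun c => b.2 (cycleMap u b.1 c)⟩
  map_add' x y := by funext b; simp [mul_add]
  map_smul' r x := by funext b; simp [mul_left_comm]

/-- The component of a state in the sector twisted by `p`. -/
def sector {S : Type*} {N : ℕ} (p : Equiv.Perm (Fin N)) :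
    (OrbBasis S N → ℂ) →ₗ[ℂ] ((Cycles p → S) → ℂ) :=
  LinearMap.funLeft ℂ ℂ (fun s => (⟨p, s⟩ : OrbBasis S N))

/-- The (formal) states of the orbifold: those invariant under all permutations of the copies. -/
def SeedCFT.orbifoldStates {S : Type*} (T : SeedCFT S) (N : ℕ) :
    Submodule ℂ (OrbBasis S N → ℂ) :=
  ⨅ u : Equiv.Perm (Fin N), LinearMap.eqLocus (T.permAct u) LinearMap.id

/-- The symmetry class: the states of the orbifold that satisfy the generalized Ishibashi conditions
`(L_n - L̄_{-n}) |x⟩ = 0`, for `n ∈ (1/k) ℤ`, on every cycle of length `k` in every sector.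
On a fixed copy (`k = 1`) this is `(L_n^i - L̄_{-n}^i) |x⟩ = 0` for that copy `i`. -/
def SeedCFT.symmetryClass {S : Type*} (T : SeedCFT S) (N : ℕ) :
    Submodule ℂ (OrbBasis S N → ℂ) :=
  T.orbifoldStates N ⊓
    ⨅ (p : Equiv.Perm (Fin N)) (c : Cycles p) (m : ℤ),
      LinearMap.eqLocus (fracMode T.c T.L c m ∘ₗ sector p)
        (fracMode T.c T.Lbar c (-m) ∘ₗ sector p)

/-! ### Irreducible representations -/

/-- Isomorphism of irreducible complex representations of `G` on spaces `ℂ ^ d`. -/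
def irrepSetoid (G : Type*) [Group G] :
    Setoid (Σ d : ℕ, {ρ : Representation ℂ G (Fin d → ℂ) // ρ.IsIrreducible}) where
  r V W := Nonempty (V.2.1.Equiv W.2.1)
  iseqv := ⟨fun _ => ⟨Representation.Equiv.refl _⟩, fun ⟨e⟩ => ⟨e.symm⟩,
    fun ⟨e⟩ ⟨f⟩ => ⟨e.trans f⟩⟩

/-- Isomorphism classes of (finite-dimensional) irreducible complex representations of `G`. -/
def Irrep (G : Type*) [Group G] : Type _ := Quotient (irrepSetoid G)

/-- The character of an irreducible representation. -/
def Irrep.char {G : Type*} [Group G] (r : Irrep G) : G → ℂ :=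
  Quotient.lift (s := irrepSetoid G) (fun V => V.2.1.character)
    (fun _ _ ⟨e⟩ => Representation.char_iso e) r

/-! ### The boundary states -/

/-- The multiplicity vectors: `n i` is the number of copies of the seed boundary state `i`, and
`∑ i, n i = N`. -/
abbrev Mult (B : Type*) (N : ℕ) : Type _ := {n : B →₀ ℕ // (n.sum fun _ k => k) = N}

/-- The copies, sorted into consecutive blocks: the `j`-th element of the block of `i` is the copy
with number `N_i + j`, where `N_i = ∑_{i' < i} n_{i'}`. -/
def layout {B : Type*} [LinearOrder B] {N : ℕ} (n : Mult B N) :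
    (Σ i : n.1.support, Fin (n.1 i)) ≃ Fin N :=
  toLex.trans (Fintype.orderIsoFinOfCardEq (Σₗ i : n.1.support, Fin (n.1 i)) (by
    rw [Fintype.card_congr (ofLex (α := Σ i : n.1.support, Fin (n.1 i))), Fintype.card_sigma]
    simp only [Fintype.card_fin]
    rw [Finset.sum_coe_sort n.1.support (fun i => n.1 i)]
    exact n.2)).symm.toEquiv

/-- The seed boundary state whose block contains a given copy. -/
def color {B : Type*} [LinearOrder B] {N : ℕ} (n : Mult B N) (k : Fin N) : B :=
  (((layout n).symm k).1 : B)

/-- The families `(g_i)` with `g_i` in the permutation group `S_{n_i}` of the block of `i`. -/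
abbrev BlockPerms {B : Type*} {N : ℕ} (n : Mult B N) : Type _ :=
  (i : n.1.support) → Equiv.Perm (Fin (n.1 i))

/-- The permutation `∏ i, g_i` of all the copies. -/
def blockPerm {B : Type*} [LinearOrder B] {N : ℕ} (n : Mult B N) (g : BlockPerms n) :
    Equiv.Perm (Fin N) :=
  (layout n).permCongr (Equiv.sigmaCongrRight g)

open Classical in
/-- For a permutation `p` and a labelling `f` of the copies that is constant on the cycles of `p`,
the state `⨂_c |(a_{f(c)})_c⟩` of the sector twisted by `p`, where `c` runs over the cycles of `p`.
The twisted state `|a_c⟩` has the same coefficients as the seed state `|a⟩`. -/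
def ket {S B : Type*} (a : B → S → ℂ) {N : ℕ} (f : Fin N → B) (p : Equiv.Perm (Fin N)) :
    OrbBasis S N → ℂ :=
  fun b => if b.1 = p then ∏ c : Cycles b.1, a (f c.base) (b.2 c) else 0

/-- The labels `(n, r)` of the boundary states. -/
abbrev CardyLabel (B : Type*) (N : ℕ) : Type _ :=
  Σ n : Mult B N, (i : n.1.support) → Irrep (Equiv.Perm (Fin (n.1 i)))

/-- The boundary state
`|n, r⟩ = (1/√N!) ∑_h ∏_i (∑_{g_i} χ^{r_i}(g_i) / n_i! |(a_i)_{h g_i h⁻¹}⟩)`. -/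
def cardyState {S B : Type*} [LinearOrder B] (a : B → S → ℂ) {N : ℕ} (l : CardyLabel B N) :
    OrbBasis S N → ℂ :=
  (1 / (Real.sqrt (N.factorial : ℝ) : ℂ)) • ∑ h : Equiv.Perm (Fin N), ∑ g : BlockPerms l.1,
    (∏ i, (l.2 i).char (g i) / ((l.1.1 i).factorial : ℂ)) •
      ket a (fun k => color l.1 (h⁻¹ k)) (h * blockPerm l.1 g * h⁻¹)

/-- The labels `(n, κ)` of the orbifold Ishibashi states. -/
abbrev IshibashiLabel (B : Type*) (N : ℕ) : Type _ :=
  Σ n : Mult B N, (i : n.1.support) → ConjClasses (Equiv.Perm (Fin (n.1 i)))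

open Classical in
/-- The orbifold Ishibashi state in which, for every `i`, the `n_i` copies of the seed state `a_i`
are linked by the cycles of a permutation of class `κ_i`, symmetrized over the copies. -/
def ishibashiState {S B : Type*} [LinearOrder B] (a : B → S → ℂ) {N : ℕ}
    (l : IshibashiLabel B N) : OrbBasis S N → ℂ :=
  ∑ h : Equiv.Perm (Fin N),
    ∑ g : BlockPerms l.1 with ∀ i, ConjClasses.mk (g i) = l.2 i,
      ket a (fun k => color l.1 (h⁻¹ k)) (h * blockPerm l.1 g * h⁻¹)

end SymOrb

end

noncomputable section

namespace SymOrb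

/-! On seed Ishibashi states the orbifold becomes a problem about finite groups. The gluing
condition at `n = 0` forces `h = h̄` wherever a coefficient is non-zero (`hol_eq_ahol`), so
rotations of cycles act without phases and a permutation merely carries one `ket` to another
(`permAct_ket`). Symmetrized kets therefore lie in the symmetry class.

Cardy's condition. A cycle of length `k` contributes the seed amplitude at `kτ`, so kets in a common
sector `p` overlap in a product of seed amplitudes over the cycles of `p` (`hasSum_ket_overlap`). In
the open channel this product is the trace of `p` on the `N`-fold product of open-string spaces: a
basis state fixed by `p` repeats one seed state along each cycle (`hasSum_openCount`). After
summation against the characters, the multiplicity of a weight is the average, over `S_N` times the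
two block groups, of a character: `conj χ^r · χ^{r'}` times the number of fixed points of a
permutation action. Such averages are dimensions of invariants, hence natural numbers
(`openMultiplicity_natural`). At weight `0` only the all-vacuum state is left, and orthogonality of
characters gives `δ` (`openMultiplicity_zero`).

Completeness. Vacuum multiplicities are limits of amplitudes as `τ → i∞`, so Cardy's condition
implies linear independence (`IsCardyFamily.linearIndependent`), and a Cardy family that spans `V`
cannot be enlarged inside `V`. Products of irreducible characters and products of class indicators
span the same functions on the block group; this identifies the spans of Cardy and Ishibashi states,
and a dimension count moves independence from the former to the latter.

Density. On finitely many coefficients the closure of the seed span is the image of a projection. A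
state that is Ishibashi in every slot can thus be expanded slot by slot into kets
(`multislot_expansion`), and averaging over `S_N` turns kets into combinations of Cardy states. For
finite `B` the span is finite-dimensional, hence closed, and density becomes equality. -/

/-! ### Characters of finite groups -/

section Characters

open Representation

variable {G : Type*} [Group G]

open scoped ComplexOrder in
/-- The character of a representation on `ℂ ^ d` is conjugated by inversion. -/
theorem conj_character [Finite G] {d : ℕ} (ρ : Representation ℂ G (Fin d → ℂ)) (g : G) :
    conj (ρ.character g) = ρ.character g⁻¹ := by
  classical
  have := Fintype.ofFinite G
  let R : G → Matrix (Fin d) (Fin d) ℂ := fun g => LinearMap.toMatrix' (ρ g)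
  have hR : ∀ a b, R (a * b) = R a * R b := fun a b => by
    simp only [R, map_mul]; exact LinearMap.toMatrix'_mul _ _
  have hR1 : R 1 = 1 := by simp [R]
  have hchar : ∀ a, ρ.character a = (R a).trace := fun a => by
    simp [R, Representation.character, LinearMap.trace_eq_matrix_trace ℂ (Pi.basisFun ℂ (Fin d)),
      LinearMap.toMatrix_eq_toMatrix']
  -- The invariant Hermitian form obtained by averaging. Its identity term makes it positive
  -- definite, hence invertible, so `(R g)†` is conjugate to `R g⁻¹` and the traces agree.
  let M : Matrix (Fin d) (Fin d) ℂ := ∑ a, (R a).conjTranspose * R a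
  have hM : M.PosDef := by
    have h1 : M = 1 + ∑ a ∈ Finset.univ.erase 1, (R a).conjTranspose * R a := by
      simp only [M]
      rw [← Finset.add_sum_erase _ _ (Finset.mem_univ (1 : G)), hR1]
      simp
    rw [h1]
    exact Matrix.PosDef.one.add_posSemidef
      (Matrix.posSemidef_sum _ fun a _ => Matrix.posSemidef_conjTranspose_mul_self _)
  have hMdet : IsUnit M.det := (Matrix.isUnit_iff_isUnit_det _).mp hM.isUnit
  have hinv : (R g).conjTranspose * M * R g = M := by
    simp only [M, Finset.mul_sum, Finset.sum_mul]
    conv_rhs => rw [← Equiv.sum_comp (Equiv.mulRight g)]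
    refine Finset.sum_congr rfl fun a _ => ?_
    simp [hR, Matrix.conjTranspose_mul, Matrix.mul_assoc]
  have hgg : R g * R g⁻¹ = 1 := by rw [← hR]; simp [hR1]
  have h2 : (R g).conjTranspose * M = M * R g⁻¹ := by
    calc (R g).conjTranspose * M = (R g).conjTranspose * M * (R g * R g⁻¹) := by
          rw [hgg, Matrix.mul_one]
      _ = M * R g⁻¹ := by rw [← Matrix.mul_assoc, hinv]
  have h3 : (R g).conjTranspose = M * R g⁻¹ * M⁻¹ := by
    rw [← h2, Matrix.mul_assoc, Matrix.mul_nonsing_inv _ hMdet, Matrix.mul_one]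
  rw [hchar, hchar]
  have h4 := Matrix.trace_conjTranspose (R g)
  rw [starRingEnd_apply, ← h4, h3, Matrix.trace_mul_comm, ← Matrix.mul_assoc,
    Matrix.nonsing_inv_mul _ hMdet, Matrix.one_mul]

/-- Transport of a representation to coordinates. -/
def coordRep {V : Type*} [AddCommGroup V] [Module ℂ V] {d : ℕ} (e : V ≃ₗ[ℂ] (Fin d → ℂ))
    (ρ : Representation ℂ G V) : Representation ℂ G (Fin d → ℂ) where
  toFun g := e.conj (ρ g)
  map_one' := by simp [Module.End.one_eq_id]
  map_mul' a b := by rw [map_mul]; exact e.conj_comp _ _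

theorem coordRep_character {V : Type*} [AddCommGroup V] [Module ℂ V] {d : ℕ}
    (e : V ≃ₗ[ℂ] (Fin d → ℂ)) (ρ : Representation ℂ G V) :
    (coordRep e ρ).character = ρ.character := by
  funext g
  exact LinearMap.trace_conj' (ρ g) e

theorem coordRep_isIrreducible {V : Type*} [AddCommGroup V] [Module ℂ V] {d : ℕ}
    (e : V ≃ₗ[ℂ] (Fin d → ℂ)) (ρ : Representation ℂ G V) (hρ : ρ.IsIrreducible) :
    (coordRep e ρ).IsIrreducible := by
  let pull : Subrepresentation (coordRep e ρ) → Subrepresentation ρ := fun W =>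
    ⟨W.toSubmodule.comap e.toLinearMap, fun g v hv => by
      have := W.apply_mem_toSubmodule g hv
      simpa [coordRep, LinearEquiv.conj_apply] using this⟩
  have hpull : Function.Injective pull := fun W W' h => by
    apply Subrepresentation.toSubmodule_injective
    have h' := congrArg Subrepresentation.toSubmodule h
    exact Submodule.comap_injective_of_surjective e.surjective h'
  have hbot : pull ⊥ = ⊥ := by
    apply Subrepresentation.toSubmodule_injective
    ext v
    change e v ∈ (⊥ : Submodule ℂ _) ↔ v ∈ (⊥ : Submodule ℂ _)
    simp
  have htop : pull ⊤ = ⊤ := by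
    apply Subrepresentation.toSubmodule_injective
    rfl
  refine { exists_pair_ne := ⟨⊥, ⊤, fun h => ?_⟩, eq_bot_or_eq_top := fun W => ?_ }
  · exact bot_ne_top (α := Subrepresentation ρ) (by rw [← hbot, ← htop, h])
  · rcases hρ.eq_bot_or_eq_top (pull W) with h | h
    · exact Or.inl (hpull (h.trans hbot.symm))
    · exact Or.inr (hpull (h.trans htop.symm))

/-- `Irrep` only knows the spaces `ℂ ^ d`; a choice of basis makes it account for irreducible
representations on all finite-dimensional spaces. -/
theorem exists_irrep_char {V : Type*} [AddCommGroup V] [Module ℂ V] [FiniteDimensional ℂ V]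
    (ρ : Representation ℂ G V) (hρ : ρ.IsIrreducible) : ∃ r : Irrep G, r.char = ρ.character :=
  ⟨Quotient.mk (irrepSetoid G) ⟨_, coordRep (Module.finBasis ℂ V).equivFun ρ,
    coordRep_isIrreducible _ ρ hρ⟩, coordRep_character _ ρ⟩

theorem Irrep.exists_rep (r : Irrep G) :
    ∃ (d : ℕ) (ρ : Representation ℂ G (Fin d → ℂ)), r.char = ρ.character := by
  induction r using Quotient.inductionOn with
  | h V => exact ⟨V.1, V.2.1, rfl⟩

theorem Irrep.char_conj (r : Irrep G) (g h : G) : r.char (h * g * h⁻¹) = r.char g := by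
  obtain ⟨d, ρ, hρ⟩ := r.exists_rep
  rw [hρ, Representation.char_conj]

open Classical in
theorem Irrep.orthonormal [Fintype G] (r s : Irrep G) :
    ∑ g : G, conj (r.char g) * s.char g = if r = s then (Fintype.card G : ℂ) else 0 := by
  induction r using Quotient.inductionOn with
  | h V =>
  induction s using Quotient.inductionOn with
  | h W =>
  have hc : (Nat.card G : ℂ) ≠ 0 := by simp
  let _ : Invertible (Nat.card G : ℂ) := invertibleOfNonzero hc
  have := V.2.2
  have := W.2.2
  have h := char_orthonormal W.2.1 V.2.1
  have h2 : ∑ g : G, conj (V.2.1.character g) * W.2.1.character g =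
      (Nat.card G : ℂ) * if Nonempty (Representation.Equiv V.2.1 W.2.1) then 1 else 0 := by
    rw [← h, ← mul_assoc, mul_inv_cancel₀ hc, one_mul]
    exact Finset.sum_congr rfl fun g _ => by rw [conj_character, mul_comm]
  have h3 : (Quotient.mk (irrepSetoid G) V = Quotient.mk (irrepSetoid G) W) ↔
      Nonempty (Representation.Equiv V.2.1 W.2.1) := Quotient.eq
  change ∑ g : G, conj (V.2.1.character g) * W.2.1.character g = _
  rw [h2, mul_ite, mul_one, mul_zero, Nat.card_eq_fintype_card]
  exact if_congr h3.symm rfl rfl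

/-- A class function orthogonal to the irreducible characters acts as zero in every
representation. -/
theorem sum_smul_eq_zero [Fintype G] (f : G → ℂ) (hf : ∀ g h, f (h * g * h⁻¹) = f g)
    (horth : ∀ r : Irrep G, ∑ g, f g * r.char g = 0) (n : ℕ) :
    ∀ (V : Type) [AddCommGroup V] [Module ℂ V] [FiniteDimensional ℂ V]
      (ρ : Representation ℂ G V), Module.finrank ℂ V = n → ∑ g, f g • ρ g = 0 := by
  induction n using Nat.strong_induction_on with
  | _ n ih =>
  intro V _ _ _ ρ hn
  have hc : (Nat.card G : ℂ) ≠ 0 := by simp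
  have : NeZero (Nat.card G : ℂ) := ⟨hc⟩
  by_cases hsimple : ∀ W : Subrepresentation ρ, W = ⊥ ∨ W = ⊤
  · rcases subsingleton_or_nontrivial V with hV | hV
    · exact Subsingleton.elim _ _
    have hirr : ρ.IsIrreducible :=
      { exists_pair_ne := ⟨⊥, ⊤, fun h => by
          have h' := congrArg Subrepresentation.toSubmodule h
          exact bot_ne_top (α := Submodule ℂ V) h'⟩
        eq_bot_or_eq_top := hsimple }
    -- Irreducible case: conjugation invariance of `f` makes `T` an intertwiner, so Schur's lemma
    -- makes it a scalar, and its trace `∑ f(g) χ(g)` vanishes.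
    let T : Module.End ℂ V := ∑ g, f g • ρ g
    have hT : ∀ g : G, T ∘ₗ ρ g = ρ g ∘ₗ T := fun g => by
      change T * ρ g = ρ g * T
      simp only [T, Finset.sum_mul, Finset.mul_sum, smul_mul_assoc, mul_smul_comm, ← map_mul]
      rw [← Equiv.sum_comp (MulAut.conj g).toEquiv]
      refine Finset.sum_congr rfl fun a _ => ?_
      simp [hf]
    let Ti : IntertwiningMap ρ ρ := ⟨T, fun g => hT g⟩
    obtain ⟨z, hz⟩ := (IsIrreducible.algebraMap_intertwiningMap_bijective_of_isAlgClosed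
      (ρ := ρ)).2 Ti
    have hz2 : T = z • LinearMap.id := by
      have := congrArg IntertwiningMap.toLinearMap hz
      rw [← show Ti.toLinearMap = T from rfl, ← this]
      rfl
    have htr : LinearMap.trace ℂ V T = 0 := by
      obtain ⟨r, hr⟩ := exists_irrep_char ρ hirr
      rw [← horth r]
      simp [T, hr, Representation.character]
    rw [hz2] at htr
    have hd : (Module.finrank ℂ V : ℂ) ≠ 0 := by
      exact_mod_cast (Module.finrank_pos (R := ℂ) (M := V)).ne'
    have : z = 0 := by simpa [hd] using htr
    change T = 0
    rw [hz2, this, zero_smul]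
  · push Not at hsimple
    obtain ⟨W, hW1, hW2⟩ := hsimple
    have : IsSemisimpleRepresentation ρ :=
      (isSemisimpleRepresentation_iff_isSemisimpleModule_asModule ρ).mpr inferInstance
    -- Maschke: a proper non-zero invariant subspace has an invariant complement, and the induction
    -- hypothesis applies to both summands.
    obtain ⟨W', hW'⟩ := exists_isCompl W
    have key : ∀ U : Subrepresentation ρ, U ≠ ⊤ → ∀ v ∈ U.toSubmodule,
        (∑ g, f g • ρ g) v = 0 := by
      intro U hU v hv
      have hlt : Module.finrank ℂ U.toSubmodule < n := by
        rw [← hn]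
        refine Submodule.finrank_lt fun h => hU ?_
        exact Subrepresentation.toSubmodule_injective h
      have h0 := ih _ hlt U.toSubmodule U.toRepresentation rfl
      have h1 := congrArg Subtype.val (LinearMap.congr_fun h0 ⟨v, hv⟩)
      simpa [Subrepresentation.toRepresentation] using h1
    have hW'top : W' ≠ ⊤ := fun h => hW1 (by
      have := hW'.inf_eq_bot
      rwa [h, inf_top_eq] at this)
    ext v
    have hv : v ∈ W.toSubmodule ⊔ W'.toSubmodule := by
      have h1 : (W ⊔ W').toSubmodule = ⊤ := by rw [hW'.sup_eq_top]; rfl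
      rw [← Subrepresentation.toSubmodule_sup, h1]
      trivial
    obtain ⟨x, hx, y, hy, rfl⟩ := Submodule.mem_sup.mp hv
    rw [map_add, key W hW2 x hx, key W' hW'top y hy]
    simp

end Characters

/-! ### Irreducible characters as a basis of the class functions. -/

section CharactersSmall

open Representation

variable {G : Type} [Group G]

/-- The regular representation on functions. -/
def regularRep (G : Type) [Group G] : Representation ℂ G (G → ℂ) where
  toFun g := LinearMap.funLeft ℂ ℂ fun h => g⁻¹ * h
  map_one' := by ext; simp [LinearMap.funLeft]
  map_mul' a b := by
    apply LinearMap.ext; intro x; funext h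
    simp [LinearMap.funLeft, mul_assoc]

/-- In the regular representation the operator `∑ f(g) ρ(g)` sends the point mass at `1` to `f`
itself. The pairing is bilinear, without conjugation. -/
theorem eq_zero_of_orthogonal [Fintype G] (f : G → ℂ) (hf : ∀ g h, f (h * g * h⁻¹) = f g)
    (horth : ∀ r : Irrep G, ∑ g, f g * r.char g = 0) : f = 0 := by
  classical
  have h := sum_smul_eq_zero f hf horth _ (G → ℂ) (regularRep G) rfl
  funext g
  have h1 := congrFun (LinearMap.congr_fun h (Pi.single 1 1)) g
  simp only [LinearMap.sum_apply, Finset.sum_apply, LinearMap.smul_apply, Pi.smul_apply] at h1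
  rw [Finset.sum_eq_single g] at h1
  · simpa [regularRep, LinearMap.funLeft] using h1
  · intro b _ hb
    have : b⁻¹ * g ≠ 1 := fun h => hb (inv_mul_eq_one.mp h)
    simp [regularRep, LinearMap.funLeft, this]
  · simp

/-- The space of class functions. -/
def classFun (G : Type) [Group G] : Submodule ℂ (G → ℂ) where
  carrier := {f | ∀ g h, f (h * g * h⁻¹) = f g}
  add_mem' hx hy g h := by simp [hx g h, hy g h]
  zero_mem' g h := rfl
  smul_mem' r x hx g h := by simp [hx g h]

open Classical in
/-- The indicator function of a conjugacy class. -/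
def classInd (κ : ConjClasses G) : G → ℂ := fun g => if ConjClasses.mk g = κ then 1 else 0

theorem linearIndependent_char [Fintype G] :
    LinearIndependent ℂ (fun r : Irrep G => r.char) := by
  classical
  rw [linearIndependent_iff']
  intro s w hw r hr
  have h1 : ∑ g : G, conj (r.char g) * (∑ i ∈ s, w i • i.char) g = 0 := by rw [hw]; simp
  have h2 : ∑ g : G, conj (r.char g) * (∑ i ∈ s, w i • i.char) g =
      ∑ i ∈ s, w i * ∑ g : G, conj (r.char g) * i.char g := by
    simp only [Finset.sum_apply, Pi.smul_apply, smul_eq_mul, Finset.mul_sum]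
    rw [Finset.sum_comm]
    exact Finset.sum_congr rfl fun i _ => Finset.sum_congr rfl fun g _ => by ring
  rw [h2] at h1
  simp only [Irrep.orthonormal, mul_ite, mul_zero, Finset.sum_ite_eq, hr, if_true] at h1
  simpa using h1

instance [Finite G] : Finite (Irrep G) := by
  have := Fintype.ofFinite G
  exact linearIndependent_char.finite

theorem span_char [Finite G] :
    Submodule.span ℂ (Set.range fun r : Irrep G => r.char) = classFun G := by
  classical
  have := Fintype.ofFinite G
  have := Fintype.ofFinite (Irrep G)
  apply le_antisymm
  · rw [Submodule.span_le]
    rintro _ ⟨r, rfl⟩ g h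
    exact r.char_conj g h
  · intro f hf
    have hc : (Fintype.card G : ℂ) ≠ 0 := by simp
    -- The orthogonal projection of `f` to the span of the characters.
    let p : G → ℂ := ∑ r : Irrep G,
      ((Fintype.card G : ℂ)⁻¹ * ∑ g, conj (r.char g) * f g) • r.char
    have hp : p ∈ Submodule.span ℂ (Set.range fun r : Irrep G => r.char) :=
      Submodule.sum_mem _ fun r _ => Submodule.smul_mem _ _ (Submodule.subset_span ⟨r, rfl⟩)
    have hpc : p ∈ classFun G := Submodule.sum_mem _ fun r _ => Submodule.smul_mem _ _
      fun g h => r.char_conj g h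
    -- The residual is conjugated because `eq_zero_of_orthogonal` expects a bilinear pairing, while
    -- the projection is built from the Hermitian one.
    have hz : (fun g => conj ((f - p) g)) = 0 := by
      refine eq_zero_of_orthogonal _ (fun g h => ?_) fun r => ?_
      · rw [(classFun G).sub_mem hf hpc g h]
      · have h0 : ∑ g, conj (r.char g) * p g = ∑ g, conj (r.char g) * f g := by
          simp only [p, Finset.sum_apply, Pi.smul_apply, smul_eq_mul, Finset.mul_sum]
          rw [Finset.sum_comm]
          have : ∀ s : Irrep G, ∑ g, conj (r.char g) *
              ((∑ k, (Fintype.card G : ℂ)⁻¹ * (conj (s.char k) * f k)) * s.char g) =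
              (∑ k, (Fintype.card G : ℂ)⁻¹ * (conj (s.char k) * f k)) *
                if r = s then (Fintype.card G : ℂ) else 0 := fun s => by
            rw [← Irrep.orthonormal, Finset.mul_sum]
            exact Finset.sum_congr rfl fun g _ => by ring
          simp only [this, mul_ite, mul_zero, Finset.sum_ite_eq, Finset.mem_univ, if_true]
          rw [Finset.sum_mul]
          exact Finset.sum_congr rfl fun g _ => by field_simp
        have h1 : ∑ g, conj (r.char g) * (f - p) g = 0 := by
          simp only [Pi.sub_apply, mul_sub, Finset.sum_sub_distrib, h0, sub_self]
        have h2 := congrArg conj h1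
        rw [map_sum, map_zero] at h2
        rw [← h2]
        exact Finset.sum_congr rfl fun g _ => by simp [mul_comm]
    have hfp : f = p := by
      funext g
      have := congrFun hz g
      simp only [Pi.zero_apply, map_eq_zero, Pi.sub_apply, sub_eq_zero] at this
      exact this
    rw [hfp]
    exact hp

theorem linearIndependent_classInd : LinearIndependent ℂ (classInd (G := G)) := by
  classical
  rw [linearIndependent_iff']
  intro s w hw κ hκ
  obtain ⟨g, rfl⟩ := ConjClasses.mk_surjective κ
  have := congrFun hw g
  simpa [classInd, hκ] using this

theorem span_classInd [Finite G] :
    Submodule.span ℂ (Set.range (classInd (G := G))) = classFun G := by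
  classical
  have := Fintype.ofFinite G
  have := Fintype.ofFinite (ConjClasses G)
  apply le_antisymm
  · rw [Submodule.span_le]
    rintro _ ⟨κ, rfl⟩ g h
    have : ConjClasses.mk (h * g * h⁻¹) = ConjClasses.mk g :=
      ConjClasses.mk_eq_mk_iff_isConj.mpr (isConj_iff.mpr ⟨h⁻¹, by group⟩)
    simp [classInd, this]
  · intro f hf
    have hfe : f = ∑ κ : ConjClasses G, f (Quotient.out κ) • classInd κ := by
      funext g
      simp only [Finset.sum_apply, Pi.smul_apply, classInd, smul_eq_mul, mul_ite, mul_one,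
        mul_zero, Finset.sum_ite_eq, Finset.mem_univ, if_true]
      have h1 : ConjClasses.mk (Quotient.out (ConjClasses.mk g)) = ConjClasses.mk g :=
        Quotient.out_eq _
      obtain ⟨h, hh⟩ := isConj_iff.mp (ConjClasses.mk_eq_mk_iff_isConj.mp h1)
      conv_lhs => rw [← hh, hf]
    rw [hfe]
    exact Submodule.sum_mem _ fun κ _ => Submodule.smul_mem _ _ (Submodule.subset_span ⟨κ, rfl⟩)

/-- Characters and class indicators are two bases of the space of class functions. -/
theorem nonempty_irrep_equiv_conjClasses (G : Type) [Group G] [Finite G] :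
    Nonempty (Irrep G ≃ ConjClasses G) := by
  have := Fintype.ofFinite G
  let b₁ := (Module.Basis.span (linearIndependent_char (G := G))).map
    (LinearEquiv.ofEq _ _ span_char)
  let b₂ := (Module.Basis.span (linearIndependent_classInd (G := G))).map
    (LinearEquiv.ofEq _ _ span_classInd)
  exact ⟨b₁.indexEquiv b₂⟩

end CharactersSmall

/-! ### Averages of characters -/

/-- The functions on a group that are characters of finite-dimensional representations. -/
def IsChar {G : Type*} [Group G] (χ : G → ℂ) : Prop :=
  ∃ (d : ℕ) (ρ : Representation ℂ G (Fin d → ℂ)), χ = ρ.character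

section IsChar

variable {G : Type*} [Group G]

theorem isChar_character {V : Type*} [AddCommGroup V] [Module ℂ V] [FiniteDimensional ℂ V]
    (ρ : Representation ℂ G V) : IsChar ρ.character :=
  ⟨_, coordRep (Module.finBasis ℂ V).equivFun ρ, (coordRep_character _ ρ).symm⟩

theorem IsChar.mul {χ ψ : G → ℂ} (hχ : IsChar χ) (hψ : IsChar ψ) :
    IsChar (fun g => χ g * ψ g) := by
  obtain ⟨d, ρ, rfl⟩ := hχ
  obtain ⟨e, σ, rfl⟩ := hψ
  have := isChar_character (ρ.tprod σ)
  rwa [Representation.char_tensor] at this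

theorem IsChar.conj [Finite G] {χ : G → ℂ} (hχ : IsChar χ) : IsChar (fun g => conj (χ g)) := by
  obtain ⟨d, ρ, rfl⟩ := hχ
  have h : (fun g => (starRingEnd ℂ) (ρ.character g)) = ρ.dual.character := by
    funext g
    rw [conj_character, Representation.char_dual]
  rw [h]
  exact isChar_character _

theorem IsChar.comp {H : Type*} [Group H] {χ : G → ℂ} (hχ : IsChar χ) (φ : H →* G) :
    IsChar (fun h => χ (φ h)) := by
  obtain ⟨d, ρ, rfl⟩ := hχ
  exact ⟨d, ρ.comp φ, rfl⟩

theorem isChar_one : IsChar (fun _ : G => (1 : ℂ)) := by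
  refine ⟨1, 1, ?_⟩
  funext g
  simp [Representation.character]

theorem IsChar.prod {ι : Type*} (s : Finset ι) {χ : ι → G → ℂ} (h : ∀ i ∈ s, IsChar (χ i)) :
    IsChar (fun g => ∏ i ∈ s, χ i g) := by
  classical
  induction s using Finset.induction_on with
  | empty => simpa using isChar_one
  | insert a s ha ih =>
    simp only [Finset.prod_insert ha]
    exact (h a (by simp)).mul (ih fun i hi => h i (by simp [hi]))

theorem Irrep.isChar (r : Irrep G) : IsChar r.char := r.exists_rep

/-- The average is the dimension of the space of invariants. Integrality and positivity of all
orbifold multiplicities come from here. -/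
theorem IsChar.average [Fintype G] {χ : G → ℂ} (h : IsChar χ) :
    ∃ n : ℕ, (Fintype.card G : ℂ)⁻¹ * ∑ g, χ g = n := by
  obtain ⟨d, ρ, rfl⟩ := h
  let _ : Invertible (Nat.card G : ℂ) := invertibleOfNonzero (by simp)
  exact ⟨_, by rw [← Representation.card_inv_mul_sum_char_eq_finrank ρ, Nat.card_eq_fintype_card]⟩

/-- The representation on functions on a set on which the group acts. -/
def permRep {A : Type*} (act : G →* Equiv.Perm A) : Representation ℂ G (A → ℂ) where
  toFun g := LinearMap.funLeft ℂ ℂ ((act g)⁻¹ : Equiv.Perm A)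
  map_one' := by ext; simp [LinearMap.funLeft]
  map_mul' a b := by
    apply LinearMap.ext; intro x; funext h
    simp [LinearMap.funLeft]

theorem permRep_character {A : Type*} [Finite A] (act : G →* Equiv.Perm A) (g : G) :
    (permRep act).character g = (Nat.card {x : A // act g x = x} : ℂ) := by
  classical
  have := Fintype.ofFinite A
  rw [Representation.character, LinearMap.trace_eq_matrix_trace ℂ (Pi.basisFun ℂ A),
    LinearMap.toMatrix_eq_toMatrix', Matrix.trace, Nat.card_eq_fintype_card,
    Fintype.card_subtype, Finset.card_filter]
  push_cast
  refine Finset.sum_congr rfl fun x _ => ?_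
  simp only [Matrix.diag_apply, LinearMap.toMatrix'_apply, permRep, MonoidHom.coe_mk,
    OneHom.coe_mk, LinearMap.funLeft_apply, Pi.single_apply, Equiv.Perm.inv_eq_iff_eq]
  simp only [eq_comm]

/-- The number of fixed points in a finite invariant set is a character. -/
theorem isChar_fixedPoints {A : Type*} (act : G →* Equiv.Perm A) (Θ : Set A) (hfin : Θ.Finite)
    (hinv : ∀ g, ∀ x ∈ Θ, act g x ∈ Θ) :
    IsChar (fun g => ({x ∈ Θ | act g x = x}.ncard : ℂ)) := by
  have hiff : ∀ g x, act g x ∈ Θ ↔ x ∈ Θ := fun g x => by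
    refine ⟨fun h => ?_, hinv g x⟩
    simpa using hinv g⁻¹ _ h
  let act' : G →* Equiv.Perm Θ :=
    { toFun := fun g => (act g).subtypePerm (p := (· ∈ Θ)) (hiff g)
      map_one' := by ext; simp
      map_mul' := fun a b => by ext x; change act (a * b) x = act a (act b x); simp }
  have := hfin.to_subtype
  have h := isChar_character (permRep act')
  convert h using 2 with g
  rw [permRep_character, ← Nat.card_coe_set_eq]
  congr 1
  refine Nat.card_congr ⟨fun x => ⟨⟨x.1, x.2.1⟩, Subtype.ext x.2.2⟩,
    fun x => ⟨x.1.1, x.1.2, congrArg Subtype.val x.2⟩, fun _ => rfl, fun _ => rfl⟩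

end IsChar

/-! ### Cycles -/

section Cycles

variable {N : ℕ} {p : Equiv.Perm (Fin N)}

theorem Cycles.of_base (c : Cycles p) : Cycles.of p c.base = c :=
  Quotient.out_eq (s := Equiv.Perm.SameCycle.setoid p) c

theorem Cycles.of_eq_of {k l : Fin N} : Cycles.of p k = Cycles.of p l ↔ p.SameCycle k l :=
  Quotient.eq (r := Equiv.Perm.SameCycle.setoid p)

theorem Cycles.of_surjective : Function.Surjective (Cycles.of p) := fun c => ⟨_, c.of_base⟩

theorem Cycles.of_apply (k : Fin N) : Cycles.of p (p k) = Cycles.of p k := by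
  rw [Cycles.of_eq_of]; exact Equiv.Perm.sameCycle_apply_left.mpr (Equiv.Perm.SameCycle.refl _ _)

theorem Cycles.len_pos (c : Cycles p) : 0 < c.len := by
  have : Nonempty {k : Fin N // Cycles.of p k = c} := ⟨⟨c.base, c.of_base⟩⟩
  exact Nat.card_pos

theorem Cycles.len_eq_card (c : Cycles p) :
    c.len = (Finset.univ.filter fun k => Cycles.of p k = c).card := by
  rw [Cycles.len, Nat.card_eq_fintype_card, Fintype.card_subtype]

theorem Cycles.sum_len : ∑ c : Cycles p, c.len = N := by
  simp only [Cycles.len_eq_card]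
  rw [← Finset.card_eq_sum_card_fiberwise (f := Cycles.of p) (s := Finset.univ)
    (t := Finset.univ) (fun _ _ => Finset.mem_coe.mpr (Finset.mem_univ _))]
  simp

theorem Cycles.sum_comp_of {M : Type*} [CommSemiring M] (F : Cycles p → M) :
    ∑ k, F (Cycles.of p k) = ∑ c, (c.len : M) * F c := by
  rw [← Finset.sum_fiberwise (s := Finset.univ) (g := Cycles.of p)]
  refine Finset.sum_congr rfl fun c _ => ?_
  rw [Finset.sum_congr rfl fun k hk => by rw [(Finset.mem_filter.mp hk).2], Finset.sum_const,
    Cycles.len_eq_card, nsmul_eq_mul]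

theorem zpow_invariant {X : Type*} {f : Fin N → X} (hf : ∀ k, f (p k) = f k) (j : ℤ) (k : Fin N) :
    f ((p ^ j) k) = f k := by
  induction j generalizing k with
  | zero => rfl
  | succ n ih => rw [zpow_add_one, Equiv.Perm.mul_apply, ih, hf]
  | pred n ih =>
    rw [zpow_sub_one, Equiv.Perm.mul_apply, ih, ← hf]; simp

theorem Cycles.apply_eq_of_of_eq {X : Type*} {f : Fin N → X} (hf : ∀ k, f (p k) = f k)
    {k l : Fin N} (h : Cycles.of p k = Cycles.of p l) : f k = f l := by
  obtain ⟨j, rfl⟩ := Cycles.of_eq_of.mp h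
  rw [zpow_invariant hf]

theorem Cycles.apply_base_of {X : Type*} {f : Fin N → X} (hf : ∀ k, f (p k) = f k) (k : Fin N) :
    f (Cycles.of p k).base = f k :=
  Cycles.apply_eq_of_of_eq hf (Cycles.of_base _)

theorem cycleMap_bijective (u p : Equiv.Perm (Fin N)) : Function.Bijective (cycleMap u p) := by
  constructor
  · intro c d h
    obtain ⟨k, rfl⟩ := Cycles.of_surjective c
    obtain ⟨l, rfl⟩ := Cycles.of_surjective d
    have h' : Cycles.of p (u k) = Cycles.of p (u l) := h
    rw [Cycles.of_eq_of] at h' ⊢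
    have : Equiv.Perm.SameCycle (u⁻¹ * p * u⁻¹⁻¹) k l := by
      rw [Equiv.Perm.sameCycle_conj, inv_inv]; exact h'
    rwa [inv_inv] at this
  · intro d
    obtain ⟨l, rfl⟩ := Cycles.of_surjective d
    exact ⟨Cycles.of _ (u⁻¹ l), show Cycles.of p (u (u⁻¹ l)) = _ by simp⟩

end Cycles

/-! ### Blocks of copies -/

section Blocks

variable {B : Type*} [LinearOrder B] {N : ℕ}

theorem blockPerm_mul (n : Mult B N) (g g' : BlockPerms n) :
    blockPerm n (g * g') = blockPerm n g * blockPerm n g' := by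
  ext k
  simp [blockPerm, Equiv.permCongr_apply]

theorem blockPerm_inv (n : Mult B N) (g : BlockPerms n) :
    blockPerm n g⁻¹ = (blockPerm n g)⁻¹ := by
  rw [eq_inv_iff_mul_eq_one, ← blockPerm_mul, inv_mul_cancel]
  ext k
  simp [blockPerm, Equiv.permCongr_apply]

theorem blockPerm_injective (n : Mult B N) : Function.Injective (blockPerm n) := by
  intro g g' h
  have h1 : Equiv.sigmaCongrRight g = Equiv.sigmaCongrRight g' := (layout n).permCongr.injective h
  exact Equiv.Perm.sigmaCongrRightHom_injective h1

theorem color_layout (n : Mult B N) (x : Σ i : n.1.support, Fin (n.1 i)) :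
    color n (layout n x) = x.1 := by
  simp [color]

theorem color_blockPerm (n : Mult B N) (g : BlockPerms n) (k : Fin N) :
    color n (blockPerm n g k) = color n k := by
  obtain ⟨x, rfl⟩ := (layout n).surjective k
  simp [blockPerm, Equiv.permCongr_apply, color_layout]

/-- Together with `color_blockPerm`, this identifies the stabilizer of the colouring with the Young
subgroup of the blocks. -/
theorem exists_blockPerm (n : Mult B N) (u : Equiv.Perm (Fin N))
    (hu : ∀ k, color n (u k) = color n k) : ∃ g : BlockPerms n, blockPerm n g = u := by
  let v : Equiv.Perm (Σ i : n.1.support, Fin (n.1 i)) := (layout n).permCongr.symm u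
  have hv : ∀ x, (v x).1 = x.1 := fun x => by
    apply Subtype.ext
    rw [← color_layout, ← color_layout]
    simp [v, Equiv.permCongr_symm, Equiv.permCongr_apply, hu]
  have hfun : ∀ i (j : Fin (n.1 (i : n.1.support))), ∃ j', v ⟨i, j⟩ = ⟨i, j'⟩ := fun i j => by
    rcases h : v ⟨i, j⟩ with ⟨i', j'⟩
    have : i' = i := by have := hv ⟨i, j⟩; rwa [h] at this
    subst this
    exact ⟨j', rfl⟩
  choose w hw using hfun
  have hinj : ∀ i, Function.Injective (w i) := fun i j j' h => by
    have : v ⟨i, j⟩ = v ⟨i, j'⟩ := by rw [hw, hw, h]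
    simpa using v.injective this
  refine ⟨fun i => Equiv.ofBijective (w i) (Finite.injective_iff_bijective.mp (hinj i)), ?_⟩
  have : Equiv.sigmaCongrRight (fun i => Equiv.ofBijective (w i)
      (Finite.injective_iff_bijective.mp (hinj i))) = v := by
    apply Equiv.ext
    rintro ⟨i, j⟩
    rw [hw]
    rfl
  rw [blockPerm, this]
  exact (layout n).permCongr.apply_symm_apply u

theorem card_color (n : Mult B N) (i : B) : Nat.card {k : Fin N // color n k = i} = n.1 i := by
  by_cases hi : i ∈ n.1.support
  · let e : Fin (n.1 i) ≃ {k : Fin N // color n k = i} :=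
      Equiv.ofBijective (fun j => ⟨layout n ⟨⟨i, hi⟩, j⟩, color_layout n _⟩) (by
        constructor
        · intro j j' h
          have := (layout n).injective (congrArg Subtype.val h)
          simpa using this
        · rintro ⟨k, hk⟩
          obtain ⟨⟨⟨i', hi'⟩, j⟩, rfl⟩ := (layout n).surjective k
          rw [color_layout] at hk
          obtain rfl : i' = i := hk
          exact ⟨j, rfl⟩)
    rw [← Nat.card_congr e, Nat.card_eq_fintype_card, Fintype.card_fin]
  · rw [Finsupp.notMem_support_iff.mp hi]
    have : IsEmpty {k : Fin N // color n k = i} :=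
      ⟨fun k => hi (k.2 ▸ ((layout n).symm k.1).1.2)⟩
    exact Nat.card_of_isEmpty

/-- The sizes of the colour classes determine `n` and do not change under relabelling of the copies.
-/
theorem eq_of_color_comp (n n' : Mult B N) (h h' : Equiv.Perm (Fin N))
    (hc : ∀ k, color n (h k) = color n' (h' k)) : n = n' := by
  apply Subtype.ext
  ext i
  rw [← card_color n i, ← card_color n' i]
  let e₁ : {k // color n (h k) = i} ≃ {k // color n k = i} :=
    Equiv.subtypeEquiv h fun k => Iff.rfl
  let e₂ : {k // color n (h k) = i} ≃ {k // color n' k = i} :=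
    Equiv.subtypeEquiv h' fun k => by rw [hc]
  exact Nat.card_congr (e₁.symm.trans e₂)

/-- Take for `n` the fibre sizes of `f`, and match the fibres of `f` with the blocks one by one. -/
theorem exists_color (f : Fin N → B) :
    ∃ (n : Mult B N) (h : Equiv.Perm (Fin N)), ∀ k, f (h k) = color n k := by
  let n : Mult B N := ⟨∑ k, Finsupp.single (f k) 1, by
    rw [← Finsupp.sum_finsetSum_index (by simp) (by simp)]
    simp⟩
  have hcard : ∀ i, Nat.card {k : Fin N // f k = i} = n.1 i := fun i => by
    rw [Nat.card_eq_fintype_card, Fintype.card_subtype, Finset.card_filter]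
    simp [n, Finsupp.finsetSum_apply, Finsupp.single_apply]
  have e : ∀ i, {k : Fin N // color n k = i} ≃ {k : Fin N // f k = i} := fun i =>
    Classical.choice (Finite.card_eq.mp ((card_color n i).trans (hcard i).symm))
  exact ⟨n, Equiv.ofFiberEquiv e, fun k => Equiv.ofFiberEquiv_map e k⟩

end Blocks

/-! ### Formal states -/

section States

variable {S : Type*} (T : SeedCFT S) {N : ℕ}

theorem mem_ishibashiSpace {x : S → ℂ} :
    x ∈ T.ishibashiSpace ↔ ∀ n, formalMode T.L n x = formalMode T.Lbar (-n) x := by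
  simp [SeedCFT.ishibashiSpace, LinearMap.mem_eqLocus]

/-- The gluing condition for the zero modes, which are diagonal. It makes every rotation phase in
`permAct` trivial on the states at hand. -/
theorem hol_eq_ahol {x : S → ℂ} (hx : x ∈ T.ishibashiSpace) {s : S} (hs : x s ≠ 0) :
    T.hol s = T.ahol s := by
  have h := congrFun ((mem_ishibashiSpace T).mp hx 0) s
  simp only [formalMode, LinearMap.coe_mk, AddHom.coe_mk, neg_zero, T.L_zero, T.Lbar_zero,
    zero_mul, Finsupp.sum_single_index, map_zero, Complex.conj_ofReal] at h
  exact_mod_cast mul_right_cancel₀ hs h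

/-- The fractional Ishibashi conditions on a cycle say that the state is a seed Ishibashi state in
the corresponding factor. -/
theorem fracMode_eq_iff {p : Equiv.Perm (Fin N)} (c : Cycles p) (y : (Cycles p → S) → ℂ) :
    (∀ m, fracMode T.c T.L c m y = fracMode T.c T.Lbar c (-m) y) ↔
      ∀ s, (fun t => y (Function.update s c t)) ∈ T.ishibashiSpace := by
  have hlen : (1 / (c.len : ℂ)) ≠ 0 := by
    have := c.len_pos.ne'
    simpa using this
  -- The shift at `m = 0` is the same on both sides, and the factor `1/k` is non-zero; both drop
  -- out.
  have h1 : ∀ m, fracMode T.c T.L c m y = fracMode T.c T.Lbar c (-m) y ↔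
      slot (formalMode T.L m) c y = slot (formalMode T.Lbar (-m)) c y := fun m => by
    simp only [fracMode, LinearMap.add_apply, LinearMap.smul_apply, neg_eq_zero, add_left_inj]
    exact (smul_right_injective _ hlen).eq_iff
  simp only [h1, mem_ishibashiSpace]
  constructor
  · intro h s m
    funext t
    have h2 := congrFun (h m) (Function.update s c t)
    simpa [slot] using h2
  · intro h m
    funext s
    exact congrFun (h s m) (s c)

theorem mem_symmetryClass {x : OrbBasis S N → ℂ} :
    x ∈ T.symmetryClass N ↔ (∀ u, T.permAct u x = x) ∧
      ∀ (p : Equiv.Perm (Fin N)) (c : Cycles p) (s : Cycles p → S),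
        (fun t => x ⟨p, Function.update s c t⟩) ∈ T.ishibashiSpace := by
  have h := fun (p : Equiv.Perm (Fin N)) (c : Cycles p) => fracMode_eq_iff T c (sector p x)
  simp only [SeedCFT.symmetryClass, SeedCFT.orbifoldStates, Submodule.mem_inf,
    Submodule.mem_iInf, LinearMap.mem_eqLocus, LinearMap.comp_apply, LinearMap.id_apply, h]
  rfl

variable {B : Type*} {a : B → S → ℂ}

theorem ket_self (f : Fin N → B) (p : Equiv.Perm (Fin N)) (s : Cycles p → S) :
    ket a f p ⟨p, s⟩ = ∏ c, a (f c.base) (s c) := by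
  simp [ket]

theorem ket_of_ne (f : Fin N → B) {p q : Equiv.Perm (Fin N)} (h : q ≠ p) (s : Cycles q → S) :
    ket a f p ⟨q, s⟩ = 0 := by
  simp [ket, h]

/-- As a function of one slot, a ket is a scalar multiple of a seed boundary state, or zero. -/
theorem ket_mem_slots (ha : ∀ i, a i ∈ T.ishibashiSpace) (f : Fin N → B)
    (q p : Equiv.Perm (Fin N)) (c : Cycles p) (s : Cycles p → S) :
    (fun t => ket a f q ⟨p, Function.update s c t⟩) ∈ T.ishibashiSpace := by
  by_cases h : p = q
  · subst h
    have : (fun t => ket a f p ⟨p, Function.update s c t⟩) =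
        (∏ d ∈ Finset.univ.erase c, a (f d.base) (s d)) • a (f c.base) := by
      funext t
      rw [ket_self, ← Finset.prod_erase_mul _ _ (Finset.mem_univ c), Function.update_self,
        Pi.smul_apply, smul_eq_mul]
      congr 1
      exact Finset.prod_congr rfl fun d hd => by
        rw [Function.update_of_ne (Finset.ne_of_mem_erase hd)]
    rw [this]
    exact Submodule.smul_mem _ _ (ha _)
  · simp only [ket_of_ne f h]
    exact Submodule.zero_mem _

/-- The twist phases disappear because only spin-zero states occur, and the choice of base points on
the cycles is harmless because `f` is constant along them. -/
theorem permAct_ket (ha : ∀ i, a i ∈ T.ishibashiSpace) (u : Equiv.Perm (Fin N)) (f : Fin N → B)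
    (p : Equiv.Perm (Fin N)) (hf : ∀ k, f (p k) = f k) :
    T.permAct u (ket a f p) = ket a (fun k => f (u⁻¹ k)) (u * p * u⁻¹) := by
  funext ⟨q, s⟩
  change (∏ c : Cycles (u⁻¹ * q * u), _) * ket a f p ⟨u⁻¹ * q * u, _⟩ = _
  by_cases h : u⁻¹ * q * u = p
  · subst h
    have hq : u * (u⁻¹ * q * u) * u⁻¹ = q := by group
    have hrhs : ket a (fun k => f (u⁻¹ k)) (u * (u⁻¹ * q * u) * u⁻¹) ⟨q, s⟩ =
        ∏ c : Cycles q, a (f (u⁻¹ c.base)) (s c) := by rw [hq]; exact ket_self _ _ _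
    rw [hrhs, ket_self, ← Finset.prod_mul_distrib]
    refine Fintype.prod_bijective _ (cycleMap_bijective u q) _ _ fun c => ?_
    have hbase : f (u⁻¹ (cycleMap u q c).base) = f c.base := by
      obtain ⟨j, hj⟩ := exists_turn u q c
      have hinv : ∀ k, f (u⁻¹ (q k)) = f (u⁻¹ k) := fun k => by
        rw [← hf (u⁻¹ k)]; simp
      have := zpow_invariant (f := fun k => f (u⁻¹ k)) hinv j (cycleMap u q c).base
      simp only [hj] at this
      simp only [← Equiv.Perm.mul_apply, inv_mul_cancel, Equiv.Perm.one_apply] at this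
      exact this.symm
    rw [hbase]
    -- Where the coefficient is zero the phase is irrelevant; elsewhere the spin vanishes and the
    -- phase is `1`.
    by_cases h0 : a (f c.base) (s (cycleMap u q c)) = 0
    · simp only [h0, mul_zero]
    · rw [hol_eq_ahol T (ha _) h0]
      simp
  · have h' : q ≠ u * p * u⁻¹ := fun hq => h (by rw [hq]; group)
    rw [ket_of_ne f h, ket_of_ne _ h', mul_zero]

variable [LinearOrder B]

/-- The symmetrization over all copies of the states in the sectors of the permutations of the
blocks of `n`, weighted by a function on these permutations. -/
def symState (a : B → S → ℂ) (n : Mult B N) : (BlockPerms n → ℂ) →ₗ[ℂ] (OrbBasis S N → ℂ) where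
  toFun φ := ∑ h : Equiv.Perm (Fin N), ∑ g : BlockPerms n,
    φ g • ket a (fun k => color n (h⁻¹ k)) (h * blockPerm n g * h⁻¹)
  map_add' φ ψ := by simp [add_smul, Finset.sum_add_distrib]
  map_smul' r φ := by simp [mul_smul, Finset.smul_sum]

theorem color_conj_invariant (n : Mult B N) (h : Equiv.Perm (Fin N)) (g : BlockPerms n)
    (k : Fin N) : color n (h⁻¹ ((h * blockPerm n g * h⁻¹) k)) = color n (h⁻¹ k) := by
  simp [color_blockPerm]

/-- Acting with `u` only translates the summation variable `h` to `u h`. -/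
theorem symState_mem (ha : ∀ i, a i ∈ T.ishibashiSpace) (n : Mult B N) (φ : BlockPerms n → ℂ) :
    symState a n φ ∈ T.symmetryClass N := by
  rw [mem_symmetryClass]
  constructor
  · intro u
    change T.permAct u (∑ h : Equiv.Perm (Fin N), ∑ g : BlockPerms n,
      φ g • ket a (fun k => color n (h⁻¹ k)) (h * blockPerm n g * h⁻¹)) =
      ∑ h : Equiv.Perm (Fin N), ∑ g : BlockPerms n,
      φ g • ket a (fun k => color n (h⁻¹ k)) (h * blockPerm n g * h⁻¹)
    simp only [map_sum, map_smul]
    conv_rhs => rw [← Equiv.sum_comp (Equiv.mulLeft u)]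
    refine Finset.sum_congr rfl fun h _ => Finset.sum_congr rfl fun g _ => ?_
    rw [permAct_ket T ha u _ _ (color_conj_invariant n h g)]
    simp [mul_assoc]
  · intro p c s
    have : (fun t => symState a n φ ⟨p, Function.update s c t⟩) =
        ∑ h : Equiv.Perm (Fin N), ∑ g : BlockPerms n, φ g • fun t =>
          ket a (fun k => color n (h⁻¹ k)) (h * blockPerm n g * h⁻¹)
            ⟨p, Function.update s c t⟩ := by
      funext t
      simp [symState, Finset.sum_apply]
    rw [this]
    exact Submodule.sum_mem _ fun h _ => Submodule.sum_mem _ fun g _ =>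
      Submodule.smul_mem _ _ (ket_mem_slots T ha _ _ _ _ _)

theorem cardyState_eq (l : CardyLabel B N) :
    cardyState a l = (1 / (Real.sqrt (N.factorial : ℝ) : ℂ)) •
      symState a l.1 (fun g => ∏ i, (l.2 i).char (g i) / ((l.1.1 i).factorial : ℂ)) := rfl

theorem ishibashiState_eq (l : IshibashiLabel B N) :
    ishibashiState a l = symState a l.1 (fun g => ∏ i, classInd (l.2 i) (g i)) := by
  classical
  simp only [ishibashiState, symState, LinearMap.coe_mk, AddHom.coe_mk]
  refine Finset.sum_congr rfl fun h _ => ?_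
  rw [Finset.sum_filter]
  refine Finset.sum_congr rfl fun g _ => ?_
  by_cases hg : ∀ i, ConjClasses.mk (g i) = l.2 i
  · rw [if_pos hg]
    simp [classInd, hg]
  · rw [if_neg hg]
    push Not at hg
    obtain ⟨i, hi⟩ := hg
    rw [Finset.prod_eq_zero (Finset.mem_univ i) (by simp [classInd, hi]), zero_smul]

theorem cardyState_mem (ha : ∀ i, a i ∈ T.ishibashiSpace) (l : CardyLabel B N) :
    cardyState a l ∈ T.symmetryClass N := by
  rw [cardyState_eq]
  exact Submodule.smul_mem _ _ (symState_mem T ha _ _)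

theorem ishibashiState_mem (ha : ∀ i, a i ∈ T.ishibashiSpace) (l : IshibashiLabel B N) :
    ishibashiState a l ∈ T.symmetryClass N := by
  rw [ishibashiState_eq]
  exact symState_mem T ha _ _

end States

/-! ### Products of sums -/

theorem hasSum_of_finset {ι E : Type*} [AddCommMonoid E] [TopologicalSpace E] {f : ι → E}
    (s : Finset ι)
    (hf : ∀ b ∉ s, f b = 0) : HasSum f (∑ b ∈ s, f b) :=
  hasSum_sum_of_ne_finset_zero hf

theorem HasSum.mul_complex {X Y : Type*} {F : X → ℂ} {G : Y → ℂ} {z w : ℂ} (hF : HasSum F z)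
    (hG : HasSum G w) : HasSum (fun x : X × Y => F x.1 * G x.2) (z * w) :=
  hF.mul hG (summable_mul_of_summable_norm hF.summable.norm hG.summable.norm)

/-- Unconditional convergence in `ℂ` is absolute, so the series can be multiplied one factor at a
time. -/
theorem hasSum_pi_prod {ι X : Type*} [Fintype ι] {F : ι → X → ℂ} {Z : ι → ℂ}
    (h : ∀ i, HasSum (F i) (Z i)) :
    HasSum (fun s : ι → X => ∏ i, F i (s i)) (∏ i, Z i) := by
  have key : ∀ (n : ℕ) (F : Fin n → X → ℂ) (Z : Fin n → ℂ), (∀ i, HasSum (F i) (Z i)) →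
      HasSum (fun s : Fin n → X => ∏ i, F i (s i)) (∏ i, Z i) := by
    intro n
    induction n with
    | zero =>
      intro F Z _
      simp only [Finset.univ_eq_empty, Finset.prod_empty]
      simp
    | succ n ih =>
      intro F Z hF
      have h1 := ih (fun i => F i.succ) (fun i => Z i.succ) fun i => hF i.succ
      have h2 := HasSum.mul_complex (hF 0) h1
      let e : X × (Fin n → X) ≃ (Fin (n + 1) → X) := Fin.consEquiv fun _ => X
      rw [Fin.prod_univ_succ]
      refine e.hasSum_iff.mp ?_
      convert h2 using 2 with x
      simp [Fin.prod_univ_succ, e]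
  let e := Fintype.equivFin ι
  have h1 := key _ (fun i => F (e.symm i)) (fun i => Z (e.symm i)) fun i => h _
  rw [Equiv.prod_comp e.symm] at h1
  let e' : (Fin (Fintype.card ι) → X) ≃ (ι → X) := Equiv.arrowCongr e.symm (Equiv.refl X)
  refine e'.hasSum_iff.mp ?_
  convert h1 using 2 with s
  simp only [Function.comp]
  rw [← Equiv.prod_comp e.symm]
  simp [e', Equiv.arrowCongr]

/-- A sum with multiplicities as a sum over all the states. -/
theorem hasSum_multiplicity {m : ℝ → ℕ} {e : ℝ → ℂ} {z : ℂ}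
    (h : HasSum (fun x => (m x : ℂ) * e x) z) :
    HasSum (fun x : ℝ × ℕ => if x.2 < m x.1 then e x.1 else 0) z := by
  have hinner : ∀ (x : ℝ) (w : ℂ),
      HasSum (fun j : ℕ => if j < m x then w else 0) ((m x : ℂ) * w) := fun x w => by
    have := hasSum_of_finset (f := fun j : ℕ => if j < m x then w else 0)
      (Finset.range (m x)) (fun j hj => by simp at hj; simp [hj])
    convert this using 1
    rw [Finset.sum_congr rfl fun j hj => if_pos (Finset.mem_range.mp hj)]
    simp
  have hinner' : ∀ x : ℝ,
      HasSum (fun j : ℕ => ‖if j < m x then e x else 0‖) ‖(m x : ℂ) * e x‖ := fun x => by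
    have := hasSum_of_finset (f := fun j : ℕ => ‖if j < m x then e x else 0‖)
      (Finset.range (m x)) (fun j hj => by simp at hj; simp [hj])
    convert this using 1
    rw [Finset.sum_congr rfl fun j hj => by rw [if_pos (Finset.mem_range.mp hj)]]
    simp
  have hs : Summable (fun x : ℝ × ℕ => if x.2 < m x.1 then e x.1 else 0) := by
    rw [← summable_norm_iff, summable_prod_of_nonneg fun _ => norm_nonneg _]
    refine ⟨fun x => (hinner' x).summable, ?_⟩
    simp only [fun x => (hinner' x).tsum_eq]
    exact h.summable.norm
  have h1 := hs.hasSum.prod_fiberwise fun x => hinner x (e x)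
  rw [h.unique h1]
  exact hs.hasSum

/-! ### The closed-string channel -/

/-- The modular parameter `k τ`. -/
def scaleTau (k : ℕ) (hk : 0 < k) (τ : UpperHalfPlane) : UpperHalfPlane :=
  ⟨k * τ, by
    have := τ.im_pos
    have : 0 < (k : ℝ) * τ.im := by positivity
    simpa using this⟩

theorem coe_scaleTau (k : ℕ) (hk : 0 < k) (τ : UpperHalfPlane) :
    (scaleTau k hk τ : ℂ) = k * τ := rfl

section Closed

variable {S : Type*} (T : SeedCFT S) {B : Type*} {a : B → S → ℂ} {N : ℕ}

/-- The shifts `(c/24)(k - 1/k)` of both chiralities turn the vacuum energy `k c/12` of a cycle into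
`c/(12k)`, leaving the seed exponent divided by `k`. -/
theorem orbDim_sub (p : Equiv.Perm (Fin N)) (s : Cycles p → S) :
    (T.orbDim N ⟨p, s⟩ : ℂ) - ((N * T.c : ℝ) : ℂ) / 12 =
      ∑ c, ((T.dim (s c) : ℂ) - T.c / 12) / c.len := by
  have h : T.orbDim N ⟨p, s⟩ - N * T.c / 12 = ∑ c, (T.dim (s c) - T.c / 12) / c.len := by
    have hN : (N : ℝ) = ∑ c : Cycles p, (c.len : ℝ) := by exact_mod_cast Cycles.sum_len.symm
    rw [hN, SeedCFT.orbDim, orbWeight, orbWeight, ← Finset.sum_add_distrib, Finset.sum_mul,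
      Finset.sum_div, ← Finset.sum_sub_distrib]
    refine Finset.sum_congr rfl fun c _ => ?_
    have := c.len_pos.ne'
    simp only [SeedCFT.dim]
    field_simp
    ring
  exact_mod_cast congrArg (fun x : ℝ => (x : ℂ)) h

/-- Different sectors are orthogonal. In a common sector the sum factorizes over the cycles, and
dividing the exponent by the length `k` amounts to replacing `τ` by `kτ`. -/
theorem hasSum_ket_overlap {Z : B → B → UpperHalfPlane → ℂ}
    (hZ : ∀ i j (τ : UpperHalfPlane), HasSum (fun s => conj (a i s) * a j s *
      Complex.exp (-(2 * Real.pi * Complex.I / (τ : ℂ)) *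
        (((T.dim s : ℂ) - (T.c : ℂ) / 12) / 2))) (Z i j τ))
    (f f' : Fin N → B) (p p' : Equiv.Perm (Fin N)) (τ : UpperHalfPlane) :
    HasSum (fun b : OrbBasis S N => conj (ket a f p b) * ket a f' p' b *
      Complex.exp (-(2 * Real.pi * Complex.I / (τ : ℂ)) *
        (((T.orbDim N b : ℂ) - ((N * T.c : ℝ) : ℂ) / 12) / 2)))
      (if p = p' then ∏ c : Cycles p, Z (f c.base) (f' c.base) (scaleTau c.len c.len_pos τ)
        else 0) := by
  split_ifs with hp
  · subst hp
    have hinj : Function.Injective (fun s : Cycles p → S => (⟨p, s⟩ : OrbBasis S N)) :=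
      fun s s' h => eq_of_heq (Sigma.mk.inj h).2
    rw [← hinj.hasSum_iff]
    · refine (hasSum_pi_prod fun c : Cycles p =>
        hZ (f c.base) (f' c.base) (scaleTau c.len c.len_pos τ)).congr_fun fun s => ?_
      simp only [Function.comp, ket_self, orbDim_sub]
      rw [map_prod, Finset.prod_mul_distrib, Finset.prod_mul_distrib, Finset.sum_div,
        Finset.mul_sum, Complex.exp_sum]
      congr 1
      refine Finset.prod_congr rfl fun c _ => ?_
      rw [coe_scaleTau]
      congr 1
      ring
    · rintro ⟨q, s⟩ hq
      have : q ≠ p := fun h => hq (by subst h; exact ⟨s, rfl⟩)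
      rw [ket_of_ne f this]
      simp
  · convert hasSum_zero with b
    obtain ⟨q, s⟩ := b
    by_cases h : q = p
    · rw [ket_of_ne f' (show q ≠ p' from fun h' => hp (h.symm.trans h'))]
      simp
    · rw [ket_of_ne f h]
      simp

end Closed

/-! ### The open-string channel -/

section Open

variable {B : Type*} {N : ℕ}

/-- The open-string states of total weight `E` on `N` copies, where copy `k` carries one of the
`m (f k) (f' k) h` states of weight `h` of the seed theory. -/
def openStates (m : B → B → ℝ → ℕ) (f f' : Fin N → B) (E : ℝ) : Set (Fin N → ℝ × ℕ) :=
  {b | (∀ k, (b k).2 < m (f k) (f' k) (b k).1) ∧ ∑ k, (b k).1 = E}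

/-- The number of open-string states of weight `E` that are invariant under `p`. -/
def openCount (m : B → B → ℝ → ℕ) (f f' : Fin N → B) (p : Equiv.Perm (Fin N)) (E : ℝ) : ℕ :=
  {b ∈ openStates m f f' E | ∀ k, b (p k) = b k}.ncard

/-- Terms of a convergent series tend to zero, whereas each non-zero term of weight at most `E` has
norm at least `δ E`. -/
theorem finite_spectrum {m : ℝ → ℕ} {e : ℝ → ℂ} {δ : ℝ → ℝ} (hδ : Antitone δ)
    (hδ0 : ∀ E, 0 < δ E) (he : ∀ E, ‖e E‖ = δ E)
    (h : Summable fun x => (m x : ℂ) * e x) (E : ℝ) :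
    {x : ℝ × ℕ | x.2 < m x.1 ∧ x.1 ≤ E}.Finite := by
  have h1 : {x : ℝ | m x ≠ 0 ∧ x ≤ E}.Finite := by
    have h2 := h.tendsto_cofinite_zero.norm
    rw [norm_zero] at h2
    have h3 := h2.eventually (gt_mem_nhds (hδ0 E))
    rw [Filter.eventually_cofinite] at h3
    refine h3.subset fun x hx => ?_
    simp only [Set.mem_ofPred_eq, not_lt, norm_mul, he, Complex.norm_natCast]
    have h4 : (1 : ℝ) ≤ m x := by exact_mod_cast Nat.one_le_iff_ne_zero.mpr hx.1
    nlinarith [hδ hx.2, hδ0 x, hδ0 E]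
  refine (h1.biUnion (t := fun x => (fun j => (x, j)) '' Set.Iio (m x))
    fun x _ => (Set.finite_Iio _).image _).subset ?_
  rintro ⟨x, j⟩ ⟨hx, hxE⟩
  simp only [Set.mem_iUnion]
  exact ⟨x, ⟨by have : j < m x := hx; omega, hxE⟩, j, hx, rfl⟩

variable {C : ℝ} {m : B → B → ℝ → ℕ} {Z : B → B → UpperHalfPlane → ℂ}

theorem openStates_finite (hneg : ∀ i j, ∀ h < 0, m i j h = 0)
    (hfin : ∀ i j E, {x : ℝ × ℕ | x.2 < m i j x.1 ∧ x.1 ≤ E}.Finite)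
    (f f' : Fin N → B) (E : ℝ) : (openStates m f f' E).Finite := by
  refine (Set.Finite.pi' fun k => hfin (f k) (f' k) E).subset fun b hb k => ⟨hb.1 k, ?_⟩
  rw [← hb.2]
  refine Finset.single_le_sum (f := fun k => (b k).1) (fun j _ => ?_) (Finset.mem_univ k)
  by_contra hlt
  have := hb.1 j
  rw [hneg _ _ _ (not_le.mp hlt)] at this
  omega

theorem norm_exp_weight (τ : UpperHalfPlane) (h : ℝ) :
    ‖Complex.exp (2 * Real.pi * Complex.I * (τ : ℂ) * ((h : ℂ) - (C : ℂ) / 24))‖ =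
      Real.exp (-(2 * Real.pi * τ.im) * (h - C / 24)) := by
  rw [Complex.norm_exp]
  congr 1
  have : (2 * Real.pi * Complex.I * (τ : ℂ) * ((h : ℂ) - (C : ℂ) / 24)) =
      ((2 * Real.pi * (h - C / 24) : ℝ) : ℂ) * (Complex.I * τ) := by push_cast; ring
  rw [this, Complex.re_ofReal_mul]
  simp
  ring

theorem finite_spectrum_of_hasSum
    (hZ : ∀ i j (τ : UpperHalfPlane), HasSum (fun h : ℝ => (m i j h : ℂ) *
      Complex.exp (2 * Real.pi * Complex.I * (τ : ℂ) * ((h : ℂ) - (C : ℂ) / 24))) (Z i j τ))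
    (i j : B) (E : ℝ) : {x : ℝ × ℕ | x.2 < m i j x.1 ∧ x.1 ≤ E}.Finite := by
  refine finite_spectrum (δ := fun h => Real.exp (-(2 * Real.pi * UpperHalfPlane.I.im) *
    (h - C / 24))) (fun x y hxy => ?_) (fun _ => Real.exp_pos _) (norm_exp_weight _)
    (hZ i j UpperHalfPlane.I).summable E
  have := Real.pi_pos
  have hI := UpperHalfPlane.I.im_pos
  simp only [Real.exp_le_exp]
  have : 0 < 2 * Real.pi * UpperHalfPlane.I.im := by positivity
  nlinarith

/-- The trace formula for a permutation of tensor factors: an invariant state is a function on the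
cycles, and a seed state of weight `h` repeated along a cycle of length `k` contributes `exp (2πi kτ
(h - C/24))`, the seed term at `kτ`. -/
theorem hasSum_openCount (hneg : ∀ i j, ∀ h < 0, m i j h = 0)
    (hZ : ∀ i j (τ : UpperHalfPlane), HasSum (fun h : ℝ => (m i j h : ℂ) *
      Complex.exp (2 * Real.pi * Complex.I * (τ : ℂ) * ((h : ℂ) - (C : ℂ) / 24))) (Z i j τ))
    {f f' : Fin N → B} {p : Equiv.Perm (Fin N)} (hf : ∀ k, f (p k) = f k)
    (hf' : ∀ k, f' (p k) = f' k) (τ : UpperHalfPlane) :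
    HasSum (fun E : ℝ => (openCount m f f' p E : ℂ) *
      Complex.exp (2 * Real.pi * Complex.I * (τ : ℂ) * ((E : ℂ) - ((N * C : ℝ) : ℂ) / 24)))
      (∏ c : Cycles p, Z (f c.base) (f' c.base) (scaleTau c.len c.len_pos τ)) := by
  classical
  let e : ℝ → ℂ := fun E =>
    Complex.exp (2 * Real.pi * Complex.I * (τ : ℂ) * ((E : ℂ) - ((N * C : ℝ) : ℂ) / 24))
  let wt : (Cycles p → ℝ × ℕ) → ℝ := fun s => ∑ k, (s (Cycles.of p k)).1
  let V : Set (Cycles p → ℝ × ℕ) := {s | ∀ c, (s c).2 < m (f c.base) (f' c.base) (s c).1}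
  let A : ℝ → Set (Cycles p → ℝ × ℕ) := fun E => {s | s ∈ V ∧ wt s = E}
  have hlift : Function.Injective
      (fun (s : Cycles p → ℝ × ℕ) (k : Fin N) => s (Cycles.of p k)) := fun s s' h => by
    funext c
    obtain ⟨k, rfl⟩ := Cycles.of_surjective c
    exact congrFun h k
  have himage : ∀ E, (fun (s : Cycles p → ℝ × ℕ) (k : Fin N) => s (Cycles.of p k)) '' A E =
      {b ∈ openStates m f f' E | ∀ k, b (p k) = b k} := fun E => by
    ext b
    constructor
    · rintro ⟨s, ⟨hs, hw⟩, rfl⟩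
      refine ⟨⟨fun k => ?_, hw⟩, fun k => by simp only [Cycles.of_apply]⟩
      have := hs (Cycles.of p k)
      rwa [Cycles.apply_base_of hf, Cycles.apply_base_of hf'] at this
    · rintro ⟨⟨hb, hw⟩, hinv⟩
      have hb' : (fun k => b (Cycles.of p k).base) = b :=
        funext fun k => Cycles.apply_base_of hinv k
      refine ⟨fun c => b c.base, ⟨fun c => hb _, ?_⟩, hb'⟩
      rw [← hw]
      exact Finset.sum_congr rfl fun k _ => congrArg Prod.fst (Cycles.apply_base_of hinv k)
  have hcount : ∀ E, (A E).ncard = openCount m f f' p E := fun E => by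
    rw [openCount, ← himage, Set.ncard_image_of_injective _ hlift]
  have hAfin : ∀ E, (A E).Finite := fun E => by
    refine Set.Finite.of_finite_image ?_ (hlift.injOn (s := A E))
    rw [himage]
    exact (openStates_finite hneg (finite_spectrum_of_hasSum hZ) f f' E).subset
      fun b hb => hb.1
  have h1 := hasSum_pi_prod fun c : Cycles p => hasSum_multiplicity
    (hZ (f c.base) (f' c.base) (scaleTau c.len c.len_pos τ))
  have h2 : ∀ s : Cycles p → ℝ × ℕ, (∏ c, if (s c).2 < m (f c.base) (f' c.base) (s c).1 then
      Complex.exp (2 * Real.pi * Complex.I * (scaleTau c.len c.len_pos τ : ℂ) *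
        (((s c).1 : ℂ) - (C : ℂ) / 24)) else 0) = if s ∈ V then e (wt s) else 0 := fun s => by
    by_cases hs : s ∈ V
    · rw [if_pos hs, Finset.prod_congr rfl fun c _ => if_pos (hs c), ← Complex.exp_sum]
      simp only [e, wt]
      congr 1
      have hN : (N : ℂ) = ∑ c : Cycles p, (c.len : ℂ) := by
        exact_mod_cast Cycles.sum_len.symm
      rw [Cycles.sum_comp_of fun c => (s c).1]
      push_cast
      rw [hN, Finset.sum_mul, Finset.sum_div, ← Finset.sum_sub_distrib, Finset.mul_sum]
      refine Finset.sum_congr rfl fun c _ => ?_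
      rw [coe_scaleTau]
      ring
    · rw [if_neg hs]
      simp only [V, Set.mem_ofPred_eq, not_forall] at hs
      obtain ⟨c, hc⟩ := hs
      exact Finset.prod_eq_zero (Finset.mem_univ c) (if_neg hc)
  simp only [h2] at h1
  -- States are embedded together with their total weight, so that summing over the fibres of the
  -- first coordinate collects equal weights.
  have hinj : Function.Injective (fun s : Cycles p → ℝ × ℕ => (wt s, s)) :=
    fun s s' h => (Prod.ext_iff.mp h).2
  have h3 : HasSum (fun x : ℝ × (Cycles p → ℝ × ℕ) => if x.2 ∈ A x.1 then e x.1 else 0)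
      (∏ c : Cycles p, Z (f c.base) (f' c.base) (scaleTau c.len c.len_pos τ)) := by
    rw [← hinj.hasSum_iff]
    · refine h1.congr_fun fun s => ?_
      simp [A]
    · rintro ⟨E, s⟩ hx
      refine if_neg fun hA => hx ⟨s, ?_⟩
      exact Prod.ext hA.2 rfl
  refine h3.prod_fiberwise fun E => ?_
  have h4 := hasSum_of_finset (f := fun s => if s ∈ A E then e E else 0)
    (hAfin E).toFinset (fun s hs => if_neg (by simpa using hs))
  convert h4 using 1
  rw [Finset.sum_congr rfl fun s hs => if_pos ((hAfin E).mem_toFinset.mp hs), Finset.sum_const,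
    ← Set.ncard_eq_toFinset_card _ (hAfin E), hcount, nsmul_eq_mul]

theorem openCount_of_neg (hneg : ∀ i j, ∀ h < 0, m i j h = 0) (f f' : Fin N → B)
    (p : Equiv.Perm (Fin N)) {E : ℝ} (hE : E < 0) : openCount m f f' p E = 0 := by
  rw [openCount]
  suffices h : {b ∈ openStates m f f' E | ∀ k, b (p k) = b k} = ∅ by
    rw [h]; exact Set.ncard_empty _
  rw [Set.eq_empty_iff_forall_notMem]
  rintro b ⟨⟨hb, hw⟩, -⟩
  rw [← hw] at hE
  obtain ⟨k, -, hk⟩ := Finset.exists_lt_of_sum_lt (f := fun k => (b k).1) (g := fun _ => 0)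
    (s := Finset.univ) (by simpa using hE)
  have := hb k
  rw [hneg _ _ _ hk] at this
  omega

/-- Non-negative weights with sum zero all vanish, so every copy needs a seed vacuum. One exists
exactly when the two labels agree, it is unique, and the resulting state is fixed by every `p`. -/
theorem openCount_zero (hneg : ∀ i j, ∀ h < 0, m i j h = 0) (hone : ∀ i, m i i 0 = 1)
    (hne : ∀ i j, i ≠ j → m i j 0 = 0) (f f' : Fin N → B) (p : Equiv.Perm (Fin N))
    [Decidable (∀ k, f k = f' k)] : openCount m f f' p 0 = if ∀ k, f k = f' k then 1 else 0 := by
  have key : ∀ b ∈ openStates m f f' 0, (∀ k, f k = f' k) ∧ b = 0 := by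
    rintro b ⟨hb, hw⟩
    have hnn : ∀ k, 0 ≤ (b k).1 := fun k => by
      by_contra hlt
      have := hb k
      rw [hneg _ _ _ (not_le.mp hlt)] at this
      omega
    have h0 : ∀ k, (b k).1 = 0 := fun k =>
      (Finset.sum_eq_zero_iff_of_nonneg fun k _ => hnn k).mp hw k (Finset.mem_univ k)
    have h1 : ∀ k, f k = f' k ∧ (b k).2 = 0 := fun k => by
      have := hb k
      rw [h0] at this
      by_cases h : f k = f' k
      · rw [h, hone] at this
        exact ⟨h, by omega⟩
      · rw [hne _ _ h] at this
        omega
    exact ⟨fun k => (h1 k).1, funext fun k => Prod.ext (h0 k) (h1 k).2⟩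
  rw [openCount]
  split_ifs with h
  · convert Set.ncard_singleton (0 : Fin N → ℝ × ℕ)
    ext b
    constructor
    · rintro ⟨hb, -⟩
      exact (key b hb).2
    · rintro rfl
      exact ⟨⟨fun k => by simp [hone, h], by simp⟩, fun k => rfl⟩
  · suffices h : {b ∈ openStates m f f' 0 | ∀ k, b (p k) = b k} = ∅ by
      rw [h]; exact Set.ncard_empty _
    rw [Set.eq_empty_iff_forall_notMem]
    rintro b ⟨hb, -⟩
    exact h (key b hb).1

end Open

/-! ### Multiplicities in the open-string channel -/

theorem ncard_eq_sum_fiber {I J X : Type*} [Fintype I] [Fintype J] {s : Set (I × J × X)}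
    (hs : s.Finite) : s.ncard = ∑ i, ∑ j, {x | (i, j, x) ∈ s}.ncard := by
  have hfin : ∀ y : I × J, {x | (y.1, y.2, x) ∈ s}.Finite := fun y =>
    hs.preimage (f := fun x => (y.1, y.2, x)) fun x _ x' _ h => by simpa using h
  have := fun y => (hfin y).to_subtype
  rw [← Fintype.sum_prod_type']
  simp only [← Nat.card_coe_set_eq]
  rw [← Nat.card_sigma]
  exact Nat.card_congr ⟨fun x => ⟨(x.1.1, x.1.2.1), x.1.2.2, x.2⟩,
    fun x => ⟨(x.1.1, x.1.2, x.2.1), x.2.2⟩, fun _ => rfl, fun _ => rfl⟩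

section Multiplicity

variable {B : Type*} [LinearOrder B] {N : ℕ}

theorem card_blockPerms (n : Mult B N) :
    Fintype.card (BlockPerms n) = ∏ i : n.1.support, (n.1 i).factorial := by
  simp [Fintype.card_pi, Fintype.card_perm]

/-- The product of the irreducible characters of a label. -/
def labelChar (l : CardyLabel B N) (g : BlockPerms l.1) : ℂ := ∏ i, (l.2 i).char (g i)

theorem labelChar_div (l : CardyLabel B N) (g : BlockPerms l.1) :
    ∏ i, (l.2 i).char (g i) / ((l.1.1 i).factorial : ℂ) =
      (Fintype.card (BlockPerms l.1) : ℂ)⁻¹ * labelChar l g := by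
  rw [card_blockPerms, Finset.prod_div_distrib, labelChar, div_eq_inv_mul]
  push_cast
  rfl

omit [LinearOrder B] in
theorem isChar_labelChar (l : CardyLabel B N) : IsChar (labelChar l) :=
  IsChar.prod _ fun i _ => (l.2 i).isChar.comp
    (Pi.evalMonoidHom (fun i : l.1.1.support => Equiv.Perm (Fin (l.1.1 i))) i)

omit [LinearOrder B] in
theorem labelChar_conj (l : CardyLabel B N) (g v : BlockPerms l.1) :
    labelChar l (v * g * v⁻¹) = labelChar l g :=
  Finset.prod_congr rfl fun i _ => (l.2 i).char_conj (g i) (v i)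

open Classical in
theorem labelChar_orthonormal (n : Mult B N)
    (r r' : (i : n.1.support) → Irrep (Equiv.Perm (Fin (n.1 i)))) :
    ∑ g, conj (labelChar ⟨n, r⟩ g) * labelChar ⟨n, r'⟩ g =
      if r = r' then (Fintype.card (BlockPerms n) : ℂ) else 0 := by
  simp only [labelChar, map_prod, ← Finset.prod_mul_distrib]
  rw [← Fintype.prod_sum fun (i : n.1.support) (x : Equiv.Perm (Fin (n.1 i))) =>
    conj ((r i).char x) * (r' i).char x]
  simp only [Irrep.orthonormal]
  split_ifs with h
  · subst h
    simp [Fintype.card_perm]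
  · obtain ⟨i, hi⟩ := Function.ne_iff.mp h
    exact Finset.prod_eq_zero (Finset.mem_univ i) (if_neg hi)

/-- The permutations of the copies, and of the blocks of two labels, acting on pairs of
labellings of the copies together with open-string states. -/
def stringAct (X : Type*) (n n' : Mult B N) :
    Equiv.Perm (Fin N) × BlockPerms n × BlockPerms n' →*
      Equiv.Perm (Equiv.Perm (Fin N) × Equiv.Perm (Fin N) × (Fin N → X)) :=
  MonoidHom.mk' (fun x =>
    { toFun := fun y => (x.1 * y.1 * (blockPerm n x.2.1)⁻¹, x.1 * y.2.1 * (blockPerm n' x.2.2)⁻¹,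
        fun k => y.2.2 (x.1⁻¹ k))
      invFun := fun y => (x.1⁻¹ * y.1 * blockPerm n x.2.1, x.1⁻¹ * y.2.1 * blockPerm n' x.2.2,
        fun k => y.2.2 (x.1 k))
      left_inv := fun y => by simp [mul_assoc]
      right_inv := fun y => by simp [mul_assoc] })
    fun x x' => by
      ext1 y
      simp [blockPerm_mul, mul_assoc]

open Classical in
/-- The multiplicity of the weight `E` in the open-string channel. -/
def openMultiplicity (m : B → B → ℝ → ℕ) (l l' : CardyLabel B N) (E : ℝ) : ℂ :=
  (N.factorial : ℂ)⁻¹ * (Fintype.card (BlockPerms l.1) : ℂ)⁻¹ *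
    (Fintype.card (BlockPerms l'.1) : ℂ)⁻¹ *
    ∑ h : Equiv.Perm (Fin N), ∑ g : BlockPerms l.1, ∑ h' : Equiv.Perm (Fin N),
      ∑ g' : BlockPerms l'.1, conj (labelChar l g) * labelChar l' g' *
        if h * blockPerm l.1 g * h⁻¹ = h' * blockPerm l'.1 g' * h'⁻¹ then
          (openCount m (fun k => color l.1 (h⁻¹ k)) (fun k => color l'.1 (h'⁻¹ k))
            (h * blockPerm l.1 g * h⁻¹) E : ℂ) else 0

/-- The sum is recognized as the average over `S_N` and the two block groups of `conj χ · χ'` times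
the fixed-point count of `stringAct`. This is the average of a character. -/
theorem openMultiplicity_natural (m : B → B → ℝ → ℕ)
    (hfin : ∀ (f f' : Fin N → B) E, (openStates m f f' E).Finite) (l l' : CardyLabel B N)
    (E : ℝ) : ∃ M : ℕ, openMultiplicity m l l' E = M := by
  classical
  -- Two placements `h`, `h'` of the blocks, with an open-string state of weight `E` between the
  -- boundary labels that they induce.
  let Θ : Set (Equiv.Perm (Fin N) × Equiv.Perm (Fin N) × (Fin N → ℝ × ℕ)) :=
    {x | x.2.2 ∈ openStates m (fun k => color l.1 (x.1⁻¹ k)) (fun k => color l'.1 (x.2.1⁻¹ k)) E}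
  have hΘ : Θ.Finite := by
    refine ((Set.finite_univ (α := Equiv.Perm (Fin N))).prod
      ((Set.finite_univ (α := Equiv.Perm (Fin N))).prod
        (Set.finite_iUnion fun h : Equiv.Perm (Fin N) => Set.finite_iUnion
          fun h' : Equiv.Perm (Fin N) => hfin (fun k => color l.1 (h⁻¹ k))
            (fun k => color l'.1 (h'⁻¹ k)) E))).subset ?_
    rintro ⟨h, h', b⟩ hx
    exact ⟨trivial, trivial, Set.mem_iUnion.mpr ⟨h, Set.mem_iUnion.mpr ⟨h', hx⟩⟩⟩
  have hinv : ∀ x, ∀ y ∈ Θ, stringAct (ℝ × ℕ) l.1 l'.1 x y ∈ Θ := by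
    rintro ⟨w, g, g'⟩ ⟨h, h', b⟩ ⟨hb, hE⟩
    refine ⟨fun k => ?_, ?_⟩
    · have := hb (w⁻¹ k)
      simpa [stringAct, color_blockPerm] using this
    · rw [← hE]
      exact Equiv.sum_comp w⁻¹ fun k => (b k).1
  have hcount : ∀ (w : Equiv.Perm (Fin N)) (g : BlockPerms l.1) (g' : BlockPerms l'.1),
      {y ∈ Θ | stringAct (ℝ × ℕ) l.1 l'.1 (w, g, g') y = y}.ncard = ∑ h, ∑ h',
        if w = h * blockPerm l.1 g * h⁻¹ then
          if w = h' * blockPerm l'.1 g' * h'⁻¹ then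
            openCount m (fun k => color l.1 (h⁻¹ k)) (fun k => color l'.1 (h'⁻¹ k)) w E
          else 0 else 0 := by
    intro w g g'
    rw [ncard_eq_sum_fiber (hΘ.subset fun y hy => hy.1)]
    refine Finset.sum_congr rfl fun h _ => Finset.sum_congr rfl fun h' _ => ?_
    -- A fixed point requires `w` to be the conjugate of both block permutations, and `b` to be
    -- `w`-invariant: exactly what `openCount` counts in the common sector.
    have hfix : ∀ b, stringAct (ℝ × ℕ) l.1 l'.1 (w, g, g') (h, h', b) = (h, h', b) ↔
        (w = h * blockPerm l.1 g * h⁻¹ ∧ w = h' * blockPerm l'.1 g' * h'⁻¹) ∧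
          ∀ k, b (w k) = b k := fun b => by
      simp only [stringAct, MonoidHom.mk'_apply, Equiv.coe_fn_mk, Prod.mk.injEq,
        mul_inv_eq_iff_eq_mul, eq_mul_inv_iff_mul_eq, and_assoc]
      refine and_congr Iff.rfl (and_congr Iff.rfl ?_)
      rw [funext_iff, ← w.forall_congr_right]
      simp [eq_comm]
    by_cases h1 : w = h * blockPerm l.1 g * h⁻¹ ∧ w = h' * blockPerm l'.1 g' * h'⁻¹
    · rw [if_pos h1.1, if_pos h1.2, openCount]
      congr 1
      ext b
      exact and_congr Iff.rfl ((hfix b).trans (and_iff_right h1))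
    · rw [← ite_and, if_neg h1]
      convert Set.ncard_empty (Fin N → ℝ × ℕ) using 2
      exact Set.eq_empty_iff_forall_notMem.mpr fun b hb => h1 ((hfix b).mp hb.2).1
  have hχ := (((isChar_labelChar l).comp ((MonoidHom.fst (BlockPerms l.1) (BlockPerms l'.1)).comp
    (MonoidHom.snd (Equiv.Perm (Fin N)) _))).conj.mul
    ((isChar_labelChar l').comp ((MonoidHom.snd (BlockPerms l.1) (BlockPerms l'.1)).comp
    (MonoidHom.snd (Equiv.Perm (Fin N)) _)))).mul
    (isChar_fixedPoints (stringAct (ℝ × ℕ) l.1 l'.1) Θ hΘ hinv)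
  obtain ⟨M, hM⟩ := hχ.average
  refine ⟨M, ?_⟩
  rw [← hM, openMultiplicity]
  congr 1
  · rw [Fintype.card_prod, Fintype.card_prod, Fintype.card_perm, Fintype.card_fin]
    push_cast
    rw [mul_inv, mul_inv, mul_assoc]
  · simp only [Fintype.sum_prod_type, hcount, MonoidHom.comp_apply, MonoidHom.coe_fst,
      MonoidHom.coe_snd]
    push_cast
    simp only [Finset.mul_sum]
    -- It remains to reorder the sums; the extra sum over `w` collapses to `w = h g h⁻¹`.
    rw [Finset.sum_comm]
    conv_rhs => rw [Finset.sum_comm]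
    refine Finset.sum_congr rfl fun g _ => ?_
    rw [Finset.sum_congr rfl fun h _ => Finset.sum_comm, Finset.sum_comm]
    conv_rhs => rw [Finset.sum_comm]
    refine Finset.sum_congr rfl fun g' _ => ?_
    conv_rhs => rw [Finset.sum_comm]
    refine Finset.sum_congr rfl fun h _ => ?_
    conv_rhs => rw [Finset.sum_comm]
    refine Finset.sum_congr rfl fun h' _ => ?_
    simp only [mul_ite, mul_zero, Finset.sum_ite_eq', Finset.mem_univ, if_true]

theorem openMultiplicity_of_neg {m : B → B → ℝ → ℕ} (hneg : ∀ i j, ∀ h < 0, m i j h = 0)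
    (l l' : CardyLabel B N) {E : ℝ} (hE : E < 0) : openMultiplicity m l l' E = 0 := by
  simp [openMultiplicity, openCount_of_neg hneg _ _ _ hE]

-- A vacuum exists only if `h` and `h'` induce the same colouring, hence only if `n = n'` and `h' =
-- h v` with `v` in the block group. Orthogonality of the characters then finishes, the prefactors
-- cancelling the orders of the groups.
open Classical in
theorem openMultiplicity_zero {m : B → B → ℝ → ℕ} (hneg : ∀ i j, ∀ h < 0, m i j h = 0)
    (hone : ∀ i, m i i 0 = 1) (hne : ∀ i j, i ≠ j → m i j 0 = 0) (l l' : CardyLabel B N) :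
    openMultiplicity m l l' 0 = if l = l' then 1 else 0 := by
  obtain ⟨n, r⟩ := l
  obtain ⟨n', r'⟩ := l'
  simp only [openMultiplicity, openCount_zero hneg hone hne]
  by_cases hn : n = n'
  · subst hn
    have hinner : ∀ (h : Equiv.Perm (Fin N)) (g : BlockPerms n),
        ∑ h' : Equiv.Perm (Fin N), ∑ g' : BlockPerms n,
          conj (labelChar ⟨n, r⟩ g) * labelChar ⟨n, r'⟩ g' *
          (if h * blockPerm n g * h⁻¹ = h' * blockPerm n g' * h'⁻¹ then
            (((if ∀ k, color n (h⁻¹ k) = color n (h'⁻¹ k) then 1 else 0 : ℕ)) : ℂ) else 0) =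
        ∑ v : BlockPerms n, ∑ g' : BlockPerms n,
          conj (labelChar ⟨n, r⟩ g) * labelChar ⟨n, r'⟩ g' *
            if g = v * g' * v⁻¹ then 1 else 0 := by
      intro h g
      rw [← Equiv.sum_comp (Equiv.mulLeft h)]
      symm
      -- With `h' = h u`, only those `u` that preserve the colouring contribute.
      refine Finset.sum_of_injOn (blockPerm n) (blockPerm_injective n).injOn
        (fun _ _ => Finset.mem_coe.mpr (Finset.mem_univ _)) (fun u _ hu => ?_) (fun v _ => ?_)
      · refine Finset.sum_eq_zero fun g' _ => ?_
        have : ¬ ∀ k, color n (h⁻¹ k) = color n ((Equiv.mulLeft h u)⁻¹ k) := fun hc => hu (by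
          obtain ⟨v, hv⟩ := exists_blockPerm n u fun k => by
            have := hc (h (u k))
            simpa using this
          exact ⟨v, Finset.mem_coe.mpr (Finset.mem_univ _), hv⟩)
        rw [if_neg this]
        simp
      · refine Finset.sum_congr rfl fun g' _ => ?_
        have h1 : ∀ k, color n (h⁻¹ k) = color n ((Equiv.mulLeft h (blockPerm n v))⁻¹ k) :=
          fun k => by
            simp [← blockPerm_inv, color_blockPerm]
        have h2 : h * blockPerm n g * h⁻¹ = Equiv.mulLeft h (blockPerm n v) * blockPerm n g' *
            (Equiv.mulLeft h (blockPerm n v))⁻¹ ↔ g = v * g' * v⁻¹ := by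
          rw [← (blockPerm_injective n).eq_iff, blockPerm_mul, blockPerm_mul, blockPerm_inv,
            Equiv.coe_mulLeft]
          constructor
          · intro h2
            have h3 := congrArg (fun x => h⁻¹ * x * h) h2
            simpa [mul_assoc] using h3
          · intro h2
            rw [h2]
            simp [mul_assoc]
        simp only [h1, h2, implies_true, if_true, Nat.cast_one]
    have hc : (Fintype.card (BlockPerms n) : ℂ) ≠ 0 :=
      Nat.cast_ne_zero.mpr Fintype.card_ne_zero
    have hN : (N.factorial : ℂ) ≠ 0 := by exact_mod_cast N.factorial_ne_zero
    -- For each `v` the constraint determines `g` from `g'`, and conjugation invariance leaves the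
    -- same character pairing for all `v`.
    have hsum : ∑ g : BlockPerms n, ∑ v : BlockPerms n,
        ∑ g' : BlockPerms n, conj (labelChar ⟨n, r⟩ g) * labelChar ⟨n, r'⟩ g' *
            (if g = v * g' * v⁻¹ then 1 else 0) =
        Fintype.card (BlockPerms n) * if r = r' then (Fintype.card (BlockPerms n) : ℂ) else 0 := by
      rw [Finset.sum_comm, ← labelChar_orthonormal, ← nsmul_eq_mul, ← Finset.card_univ,
        ← Finset.sum_const]
      refine Finset.sum_congr rfl fun v _ => ?_
      rw [Finset.sum_comm]
      refine Finset.sum_congr rfl fun g' _ => ?_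
      simp only [mul_ite, mul_one, mul_zero, Finset.sum_ite_eq', Finset.mem_univ, if_true]
      rw [labelChar_conj]
    simp only [hinner, hsum]
    simp only [Finset.sum_const, Finset.card_univ, Fintype.card_perm, Fintype.card_fin,
      nsmul_eq_mul, Sigma.mk.injEq, heq_eq_eq, true_and]
    split_ifs
    · field_simp
    · simp
  · have h0 : ∀ h h' : Equiv.Perm (Fin N), ¬ ∀ k, color n (h⁻¹ k) = color n' (h'⁻¹ k) :=
      fun h h' hc => hn (eq_of_color_comp n n' h⁻¹ h'⁻¹ hc)
    rw [if_neg fun h => hn (congrArg Sigma.fst h)]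
    simp only [h0, if_false, Nat.cast_zero, ite_self, mul_zero, Finset.sum_const_zero]

end Multiplicity

/-! ### Cardy's condition -/

section Cardy

variable {S : Type*} (T : SeedCFT S) {B : Type*} [LinearOrder B] {a : B → S → ℂ} {N : ℕ}

theorem cardyState_eq_sum (l : CardyLabel B N) :
    cardyState a l = ∑ h : Equiv.Perm (Fin N), ∑ g : BlockPerms l.1,
      ((1 / (Real.sqrt (N.factorial : ℝ) : ℂ)) *
        ((Fintype.card (BlockPerms l.1) : ℂ)⁻¹ * labelChar l g)) •
      ket a (fun k => color l.1 (h⁻¹ k)) (h * blockPerm l.1 g * h⁻¹) := by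
  simp only [cardyState, labelChar_div, Finset.smul_sum, smul_smul]

/-- Both channels are finite combinations, with the same coefficients, of seed amplitudes; the seed
condition gives each of these a closed and an open expansion. -/
theorem isCardyFamily_cardyState (hCardy : IsCardyFamily T.c T.dim a) :
    IsCardyFamily (N * T.c) (T.orbDim N) (fun l : CardyLabel B N => cardyState a l) := by
  classical
  choose m hneg hm0 Z hclosed hopen using hCardy
  have hone : ∀ i, m i i 0 = 1 := fun i => by rw [hm0, if_pos rfl]
  have hne : ∀ i j, i ≠ j → m i j 0 = 0 := fun i j h => by rw [hm0, if_neg h]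
  have hfin := fun (f f' : Fin N → B) (E : ℝ) =>
    openStates_finite hneg (finite_spectrum_of_hasSum hopen) f f' E
  intro l l'
  choose M hM using openMultiplicity_natural m hfin l l'
  refine ⟨M, fun E hE => ?_, ?_, fun τ => ?_⟩
  · have := hM E
    rw [openMultiplicity_of_neg hneg _ _ hE] at this
    exact_mod_cast this.symm
  · have := hM 0
    rw [openMultiplicity_zero hneg hone hne] at this
    split_ifs at this ⊢ <;> exact_mod_cast this.symm
  · let coef : BlockPerms l.1 → BlockPerms l'.1 → ℂ := fun g g' =>
      (N.factorial : ℂ)⁻¹ * (Fintype.card (BlockPerms l.1) : ℂ)⁻¹ *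
        (Fintype.card (BlockPerms l'.1) : ℂ)⁻¹ * (conj (labelChar l g) * labelChar l' g')
    have hsqrt : (1 / (Real.sqrt (N.factorial : ℝ) : ℂ)) * (1 / (Real.sqrt (N.factorial : ℝ) : ℂ)) =
        (N.factorial : ℂ)⁻¹ := by
      rw [div_mul_div_comm, one_mul, ← Complex.ofReal_mul,
        Real.mul_self_sqrt (Nat.cast_nonneg _), one_div, Complex.ofReal_natCast]
    have hcl := hasSum_sum fun (h : Equiv.Perm (Fin N)) (_ : h ∈ Finset.univ) =>
      hasSum_sum fun (g : BlockPerms l.1) (_ : g ∈ Finset.univ) =>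
      hasSum_sum fun (h' : Equiv.Perm (Fin N)) (_ : h' ∈ Finset.univ) =>
      hasSum_sum fun (g' : BlockPerms l'.1) (_ : g' ∈ Finset.univ) =>
      (hasSum_ket_overlap T hclosed (fun k => color l.1 (h⁻¹ k)) (fun k => color l'.1 (h'⁻¹ k))
        (h * blockPerm l.1 g * h⁻¹) (h' * blockPerm l'.1 g' * h'⁻¹) τ).mul_left (coef g g')
    refine ⟨_, hcl.congr_fun fun b => ?_, ?_⟩
    · simp only [cardyState_eq_sum, Finset.sum_apply, Pi.smul_apply, smul_eq_mul, map_sum]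
      simp only [Finset.sum_mul]
      refine Finset.sum_congr rfl fun h _ => Finset.sum_congr rfl fun g _ => ?_
      simp only [Finset.mul_sum, Finset.sum_mul]
      refine Finset.sum_congr rfl fun h' _ => Finset.sum_congr rfl fun g' _ => ?_
      simp only [coef, map_mul, map_inv₀, map_natCast, map_div₀, map_one, Complex.conj_ofReal]
      rw [← hsqrt]
      ring
    -- Each term has the value that it has in the closed channel, so the two series have the same
    -- total.
    · have hop := hasSum_sum fun (h : Equiv.Perm (Fin N)) (_ : h ∈ Finset.univ) =>
        hasSum_sum fun (g : BlockPerms l.1) (_ : g ∈ Finset.univ) =>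
        hasSum_sum fun (h' : Equiv.Perm (Fin N)) (_ : h' ∈ Finset.univ) =>
        hasSum_sum fun (g' : BlockPerms l'.1) (_ : g' ∈ Finset.univ) =>
        show HasSum (fun E : ℝ => coef g g' *
          if h * blockPerm l.1 g * h⁻¹ = h' * blockPerm l'.1 g' * h'⁻¹ then
            (openCount m (fun k => color l.1 (h⁻¹ k)) (fun k => color l'.1 (h'⁻¹ k))
              (h * blockPerm l.1 g * h⁻¹) E : ℂ) * Complex.exp (2 * Real.pi * Complex.I * (τ : ℂ) *
                ((E : ℂ) - ((N * T.c : ℝ) : ℂ) / 24)) else 0)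
          (coef g g' * if h * blockPerm l.1 g * h⁻¹ = h' * blockPerm l'.1 g' * h'⁻¹ then
            ∏ c : Cycles (h * blockPerm l.1 g * h⁻¹), Z (color l.1 (h⁻¹ c.base))
              (color l'.1 (h'⁻¹ c.base)) (scaleTau c.len c.len_pos τ) else 0) from by
          refine HasSum.mul_left _ ?_
          split_ifs with hp
          · refine hasSum_openCount hneg hopen (color_conj_invariant l.1 h g) ?_ τ
            rw [hp]
            exact color_conj_invariant l'.1 h' g'
          · exact hasSum_zero
      refine hop.congr_fun fun E => ?_
      rw [← hM, openMultiplicity]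
      simp only [Finset.mul_sum, Finset.sum_mul]
      refine Finset.sum_congr rfl fun h _ => Finset.sum_congr rfl fun g _ =>
        Finset.sum_congr rfl fun h' _ => Finset.sum_congr rfl fun g' _ => ?_
      simp only [coef]
      split_ifs <;> ring

end Cardy

/-! ### Cardy families are linearly independent -/

section Independence

open Filter Topology

/-- Along `τ = (n+1) i`, after removal of `q ^ (-C/24)`, all terms with `h > 0` decay. The series at
`n = 0` dominates, since no `h < 0` occurs. -/
theorem tendsto_vacuum {C : ℝ} {m : ℝ → ℕ} (hneg : ∀ h < 0, m h = 0) {Z : UpperHalfPlane → ℂ}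
    (hZ : ∀ τ : UpperHalfPlane, HasSum (fun h : ℝ => (m h : ℂ) *
      Complex.exp (2 * Real.pi * Complex.I * (τ : ℂ) * ((h : ℂ) - (C : ℂ) / 24))) (Z τ)) :
    Tendsto (fun n : ℕ => Z (scaleTau (n + 1) n.succ_pos UpperHalfPlane.I) *
      Complex.exp (2 * Real.pi * Complex.I * (scaleTau (n + 1) n.succ_pos UpperHalfPlane.I : ℂ) *
        ((C : ℂ) / 24))) atTop (𝓝 (m 0 : ℂ)) := by
  classical
  have hq : ∀ n : ℕ, HasSum (fun h : ℝ => (m h : ℂ) *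
      Complex.exp ((-(2 * Real.pi * ((n : ℝ) + 1) * h) : ℝ) : ℂ))
      (Z (scaleTau (n + 1) n.succ_pos UpperHalfPlane.I) *
      Complex.exp (2 * Real.pi * Complex.I * (scaleTau (n + 1) n.succ_pos UpperHalfPlane.I : ℂ) *
        ((C : ℂ) / 24))) := fun n => by
    refine ((hZ (scaleTau (n + 1) n.succ_pos UpperHalfPlane.I)).mul_right _).congr_fun fun h => ?_
    rw [mul_assoc (m h : ℂ), ← Complex.exp_add, coe_scaleTau]
    congr 2
    push_cast
    linear_combination (-(2 * Real.pi * ((n : ℂ) + 1) * h)) * Complex.I_mul_I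
  have hnorm : ∀ (n : ℕ) (h : ℝ), ‖(m h : ℂ) *
      Complex.exp ((-(2 * Real.pi * ((n : ℝ) + 1) * h) : ℝ) : ℂ)‖ =
      m h * Real.exp (-(2 * Real.pi * ((n : ℝ) + 1) * h)) := fun n h => by
    rw [norm_mul, Complex.norm_natCast, Complex.norm_exp_ofReal]
  have hlim := tendsto_tsum_of_dominated_convergence (𝓕 := atTop)
    (f := fun (n : ℕ) (h : ℝ) => (m h : ℂ) *
      Complex.exp ((-(2 * Real.pi * ((n : ℝ) + 1) * h) : ℝ) : ℂ))
    (g := fun h => if h = 0 then (m 0 : ℂ) else 0) (hq 0).summable.norm (fun h => ?_)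
    (Eventually.of_forall fun n h => ?_)
  · rw [tsum_ite_eq] at hlim
    exact hlim.congr fun n => (hq n).tsum_eq
  · rcases lt_trichotomy h 0 with hlt | rfl | hgt
    · simp [hneg h hlt, hlt.ne]
    · simp
    · rw [if_neg hgt.ne', tendsto_zero_iff_norm_tendsto_zero]
      simp only [hnorm]
      rw [← mul_zero (m h : ℝ)]
      refine Tendsto.const_mul _ (Real.tendsto_exp_neg_atTop_nhds_zero.comp ?_)
      have : 0 < 2 * Real.pi * h := by have := Real.pi_pos; positivity
      refine ((tendsto_atTop_add_const_right _ 1 tendsto_natCast_atTop_atTop).const_mul_atTop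
        this).congr fun n => ?_
      ring
  · rw [hnorm, hnorm]
    rcases lt_or_ge h 0 with hlt | hge
    · simp [hneg h hlt]
    · refine mul_le_mul_of_nonneg_left (Real.exp_le_exp.mpr ?_) (Nat.cast_nonneg _)
      have := Real.pi_pos
      have h1 : 0 ≤ 2 * Real.pi * h * n := by positivity
      push_cast
      nlinarith

/-- Pair a vanishing combination with `x i` and let `τ → i∞`: only the vacuum survives, and its
multiplicity `δ` isolates the coefficient `w i`. This works although the states need not be
normalizable. -/
theorem IsCardyFamily.linearIndependent {σ ι : Type*} {C : ℝ} {dim : σ → ℝ} {x : ι → σ → ℂ}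
    (hx : IsCardyFamily C dim x) : LinearIndependent ℂ x := by
  classical
  rw [linearIndependent_iff']
  intro s w hw i hi
  choose m hneg hm0 Z hclosed hopen using hx
  have hzero : ∀ τ, ∑ j ∈ s, w j * Z i j τ = 0 := fun τ => by
    refine (hasSum_sum fun j _ => (hclosed i j τ).mul_left (w j)).unique ?_
    convert hasSum_zero with b
    have hb : ∑ j ∈ s, w j * x j b = 0 := by simpa using congrFun hw b
    calc _ = conj (x i b) * (∑ j ∈ s, w j * x j b) * Complex.exp (-(2 * Real.pi * Complex.I /
          (τ : ℂ)) * (((dim b : ℂ) - (C : ℂ) / 12) / 2)) := by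
          rw [Finset.mul_sum, Finset.sum_mul]
          exact Finset.sum_congr rfl fun j _ => by ring
      _ = 0 := by rw [hb]; simp
  have hlim := tendsto_finsetSum s fun j _ =>
    (tendsto_vacuum (hneg i j) (hopen i j)).const_mul (w j)
  have h0 : ∑ j ∈ s, w j * (m i j 0 : ℂ) = 0 := by
    refine tendsto_nhds_unique hlim (tendsto_const_nhds.congr fun n => ?_)
    simp only [← mul_assoc]
    rw [← Finset.sum_mul, hzero, zero_mul]
  simpa [hm0, hi] using h0

/-- A larger Cardy set would itself be linearly independent, yet its extra members lie in the span
of `x`. -/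
theorem IsCardyFamily.isCompleteIn {σ ι : Type*} {C : ℝ} {dim : σ → ℝ} {x : ι → σ → ℂ}
    (hx : IsCardyFamily C dim x) {V : Submodule ℂ (σ → ℂ)}
    (hV : Submodule.span ℂ (Set.range x) = V) : IsCompleteIn C dim x V := by
  refine ⟨hx.linearIndependent, hV, fun X hX hXV hXC => (Set.Subset.antisymm hX ?_).symm⟩
  intro y hy
  by_contra hyx
  have hnot : (⟨y, hy⟩ : X) ∉ {z : X | (z : σ → ℂ) ∈ Set.range x} := hyx
  refine hXC.linearIndependent.notMem_span_image hnot ?_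
  have hspan : y ∈ Submodule.span ℂ (Set.range x) := hV ▸ hXV hy
  refine Submodule.span_mono ?_ hspan
  exact fun z hz => ⟨⟨z, hX hz⟩, hz, rfl⟩

/-- Within a block, independence follows from the dimension of the common span; between blocks,
disjointness depends on the spans alone. -/
theorem LinearIndependent.of_span_sigma_eq {E ι : Type*} [AddCommGroup E] [Module ℂ E]
    {R K : ι → Type*} [∀ i, Finite (R i)] [∀ i, Finite (K i)] {x : ∀ i, R i → E} {y : ∀ i, K i → E}
    (hx : LinearIndependent ℂ fun l : Σ i, R i => x l.1 l.2)
    (hspan : ∀ i, Submodule.span ℂ (Set.range (x i)) = Submodule.span ℂ (Set.range (y i)))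
    (hcard : ∀ i, Nonempty (R i ≃ K i)) : LinearIndependent ℂ fun l : Σ i, K i => y l.1 l.2 := by
  refine linearIndependent_iUnion_finite (fun i => ?_) fun i t _ hit => ?_
  · have := Fintype.ofFinite (K i)
    have := Fintype.ofFinite (R i)
    have hxi : LinearIndependent ℂ (x i) := hx.comp (Sigma.mk i) sigma_mk_injective
    rw [linearIndependent_iff_card_eq_finrank_span, Set.finrank, ← hspan,
      ← Fintype.card_congr (Classical.choice (hcard i))]
    exact (finrank_span_eq_card hxi).symm
  · simp only [← hspan]
    have hd : Disjoint {l : Σ i, R i | l.1 = i} {l : Σ i, R i | l.1 ∈ t} :=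
      Set.disjoint_left.mpr fun l hl hl' => hit (by rw [← show l.1 = i from hl]; exact hl')
    refine (hx.disjoint_span_image hd).mono ?_ ?_
    · refine Submodule.span_mono ?_
      rintro _ ⟨r, rfl⟩
      exact ⟨⟨i, r⟩, rfl, rfl⟩
    · refine iSup₂_le fun j hj => Submodule.span_mono ?_
      rintro _ ⟨r, rfl⟩
      exact ⟨⟨j, r⟩, hj, rfl⟩

end Independence

/-! ### Spans -/

section Spans

theorem prod_mem_span {ι : Type*} [Fintype ι] {K X : ι → Type*} (v : ∀ i, K i → X i → ℂ)
    (φ : ∀ i, X i → ℂ) (h : ∀ i, φ i ∈ Submodule.span ℂ (Set.range (v i))) :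
    (fun x : ∀ i, X i => ∏ i, φ i (x i)) ∈
      Submodule.span ℂ (Set.range fun (κ : ∀ i, K i) (x : ∀ i, X i) => ∏ i, v i (κ i) (x i)) := by
  classical
  choose c hc using fun i => Finsupp.mem_span_range_iff_exists_finsupp.mp (h i)
  have : (fun x : ∀ i, X i => ∏ i, φ i (x i)) =
      ∑ κ ∈ Fintype.piFinset fun i => (c i).support,
        (∏ i, c i (κ i)) • fun x : ∀ i, X i => ∏ i, v i (κ i) (x i) := by
    funext x
    have h1 : ∀ i, φ i (x i) = ∑ k ∈ (c i).support, c i k * v i k (x i) := fun i => by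
      rw [← hc i]
      simp [Finsupp.sum, Finset.sum_apply]
    simp only [h1, Finset.sum_apply, Pi.smul_apply, smul_eq_mul]
    rw [Finset.prod_univ_sum]
    exact Finset.sum_congr rfl fun κ _ => Finset.prod_mul_distrib
  rw [this]
  exact Submodule.sum_mem _ fun κ _ => Submodule.smul_mem _ _ (Submodule.subset_span ⟨κ, rfl⟩)

variable {S : Type*} {B : Type*} [LinearOrder B] {a : B → S → ℂ} {N : ℕ}

theorem span_ishibashiState (n : Mult B N) :
    Submodule.span ℂ (Set.range fun κ => ishibashiState a (N := N) ⟨n, κ⟩) =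
      (Submodule.span ℂ (Set.range fun (κ : (i : n.1.support) →
        ConjClasses (Equiv.Perm (Fin (n.1 i)))) (g : BlockPerms n) =>
          ∏ i, classInd (κ i) (g i))).map (symState a n) := by
  rw [Submodule.map_span, ← Set.range_comp]
  simp only [ishibashiState_eq]
  rfl

/-- The normalization is a non-zero scalar common to all `r` and does not affect the span. -/
theorem span_cardyState (n : Mult B N) :
    Submodule.span ℂ (Set.range fun r => cardyState a (N := N) ⟨n, r⟩) =
      (Submodule.span ℂ (Set.range fun (r : (i : n.1.support) →
        Irrep (Equiv.Perm (Fin (n.1 i)))) (g : BlockPerms n) =>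
          ∏ i, (r i).char (g i))).map (symState a n) := by
  have hN : (1 / (Real.sqrt (N.factorial : ℝ) : ℂ)) ≠ 0 := by
    have : Real.sqrt (N.factorial : ℝ) ≠ 0 :=
      (Real.sqrt_pos.mpr (by exact_mod_cast N.factorial_pos)).ne'
    simpa using this
  have hc : (Fintype.card (BlockPerms n) : ℂ)⁻¹ ≠ 0 :=
    inv_ne_zero (Nat.cast_ne_zero.mpr Fintype.card_ne_zero)
  have h : ∀ r, cardyState a (N := N) ⟨n, r⟩ =
      ((1 / (Real.sqrt (N.factorial : ℝ) : ℂ)) * (Fintype.card (BlockPerms n) : ℂ)⁻¹) •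
        symState a n (fun g => ∏ i, (r i).char (g i)) := fun r => by
    have hφ : (fun g : BlockPerms n => ∏ i, (r i).char (g i) / ((n.1 i).factorial : ℂ)) =
        (Fintype.card (BlockPerms n) : ℂ)⁻¹ • fun g => ∏ i, (r i).char (g i) :=
      funext fun g => labelChar_div ⟨n, r⟩ g
    rw [cardyState_eq, mul_smul]
    exact congrArg _ ((congrArg (symState a n) hφ).trans (map_smul _ _ _))
  have hunit := IsUnit.mk0 _ (mul_ne_zero hN hc)
  simp only [h]
  rw [Submodule.map_span, ← Set.range_comp]
  conv_rhs => rw [← Submodule.span_smul_eq_of_isUnit _ _ hunit, ← Set.range_smul]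
  rfl

omit [LinearOrder B] in
theorem span_prod_char_eq (n : Mult B N) :
    Submodule.span ℂ (Set.range fun (r : (i : n.1.support) →
        Irrep (Equiv.Perm (Fin (n.1 i)))) (g : BlockPerms n) => ∏ i, (r i).char (g i)) =
      Submodule.span ℂ (Set.range fun (κ : (i : n.1.support) →
        ConjClasses (Equiv.Perm (Fin (n.1 i)))) (g : BlockPerms n) =>
          ∏ i, classInd (κ i) (g i)) := by
  apply le_antisymm
  · rw [Submodule.span_le]
    rintro _ ⟨r, rfl⟩
    refine prod_mem_span (fun i => classInd) (fun i => (r i).char) fun i => ?_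
    rw [span_classInd, ← span_char]
    exact Submodule.subset_span ⟨_, rfl⟩
  · rw [Submodule.span_le]
    rintro _ ⟨κ, rfl⟩
    refine prod_mem_span (fun (i : n.1.support) (r : Irrep (Equiv.Perm (Fin (n.1 i)))) => r.char)
      (fun i : n.1.support => classInd (κ i)) fun i => ?_
    rw [span_char, ← span_classInd]
    exact Submodule.subset_span ⟨_, rfl⟩

theorem span_cardyState_eq (n : Mult B N) :
    Submodule.span ℂ (Set.range fun r => cardyState a (N := N) ⟨n, r⟩) =
      Submodule.span ℂ (Set.range fun κ => ishibashiState a (N := N) ⟨n, κ⟩) := by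
  rw [span_cardyState, span_ishibashiState, span_prod_char_eq]

theorem span_range_sigma {ι E : Type*} [AddCommGroup E] [Module ℂ E] {R : ι → Type*}
    (x : (Σ i, R i) → E) : Submodule.span ℂ (Set.range x) =
      ⨆ i, Submodule.span ℂ (Set.range fun r => x ⟨i, r⟩) := by
  rw [← Submodule.span_iUnion, Set.range_sigma_eq_iUnion_range]

theorem span_cardyState_eq_ishibashi :
    Submodule.span ℂ (Set.range fun l : CardyLabel B N => cardyState a l) =
      Submodule.span ℂ (Set.range fun l : IshibashiLabel B N => ishibashiState a l) := by
  rw [span_range_sigma, span_range_sigma]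
  exact iSup_congr span_cardyState_eq

omit [LinearOrder B] in
theorem nonempty_label_equiv (n : Mult B N) :
    Nonempty (((i : n.1.support) → Irrep (Equiv.Perm (Fin (n.1 i)))) ≃
      ((i : n.1.support) → ConjClasses (Equiv.Perm (Fin (n.1 i))))) :=
  ⟨Equiv.piCongrRight fun _ => Classical.choice (nonempty_irrep_equiv_conjClasses _)⟩

theorem linearIndependent_ishibashiState
    (h : LinearIndependent ℂ fun l : CardyLabel B N => cardyState a l) :
    LinearIndependent ℂ fun l : IshibashiLabel B N => ishibashiState a l :=
  LinearIndependent.of_span_sigma_eq (x := fun n r => cardyState a (N := N) ⟨n, r⟩)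
    (y := fun n κ => ishibashiState a (N := N) ⟨n, κ⟩) h span_cardyState_eq nonempty_label_equiv

theorem symState_single (n : Mult B N) (g : BlockPerms n) [DecidableEq (BlockPerms n)] :
    symState a n (Pi.single g 1) = ∑ h : Equiv.Perm (Fin N),
      ket a (fun k => color n (h⁻¹ k)) (h * blockPerm n g * h⁻¹) := by
  refine Finset.sum_congr rfl fun h _ => ?_
  rw [Finset.sum_eq_single g]
  · simp
  · intro g' _ hg'
    simp [hg']
  · simp

/-- Substituting `h v` for `h` absorbs the conjugation, as `v` preserves the colouring. -/
theorem symState_single_conj (n : Mult B N) (g v : BlockPerms n) [DecidableEq (BlockPerms n)] :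
    symState a n (Pi.single (v * g * v⁻¹) 1) = symState a n (Pi.single g 1) := by
  rw [symState_single, symState_single]
  conv_rhs => rw [← Equiv.sum_comp (Equiv.mulRight (blockPerm n v))]
  refine Finset.sum_congr rfl fun h _ => ?_
  have h1 : ∀ k, color n ((Equiv.mulRight (blockPerm n v) h)⁻¹ k) = color n (h⁻¹ k) := fun k => by
    simp [← blockPerm_inv, color_blockPerm]
  simp only [h1, blockPerm_mul, blockPerm_inv]
  simp [mul_assoc]

/-- The symmetrization of a state `⨂_c |(a_{f(c)})_c⟩` is a combination of the Cardy states. -/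
theorem symState_single_mem (n : Mult B N) (g : BlockPerms n) [DecidableEq (BlockPerms n)] :
    symState a n (Pi.single g 1) ∈
      Submodule.span ℂ (Set.range fun l : CardyLabel B N => cardyState a l) := by
  classical
  rw [span_cardyState_eq_ishibashi]
  let κ : (i : n.1.support) → ConjClasses (Equiv.Perm (Fin (n.1 i))) := fun i =>
    ConjClasses.mk (g i)
  let C : Finset (BlockPerms n) := {g' | ∀ i, ConjClasses.mk (g' i) = κ i}
  -- All members of the class of `g` have the same symmetrization, so the Ishibashi state is a
  -- non-zero multiple of it.
  have h1 : ishibashiState a (N := N) ⟨n, κ⟩ = (C.card : ℂ) • symState a n (Pi.single g 1) := by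
    have h2 : (fun g' : BlockPerms n => ∏ i, classInd (κ i) (g' i)) =
        ∑ g' ∈ C, Pi.single g' (1 : ℂ) := by
      funext g'
      rw [Finset.sum_apply, Finset.sum_pi_single g' (fun _ => (1 : ℂ)) C]
      by_cases hg : ∀ i, ConjClasses.mk (g' i) = κ i
      · simp [C, hg, classInd]
      · rw [if_neg (by simpa [C] using hg)]
        push Not at hg
        obtain ⟨i, hi⟩ := hg
        exact Finset.prod_eq_zero (Finset.mem_univ i) (by simp [classInd, hi])
    rw [ishibashiState_eq]
    simp only [h2, map_sum]
    rw [Finset.sum_congr rfl fun g' hg' => ?_, Finset.sum_const, ← Nat.cast_smul_eq_nsmul ℂ]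
    have hconj : ∀ i, ∃ v, v * g i * v⁻¹ = g' i := fun i =>
      isConj_iff.mp (ConjClasses.mk_eq_mk_iff_isConj.mp ((Finset.mem_filter.mp hg').2 i).symm)
    choose v hv using hconj
    rw [← symState_single_conj n g v]
    congr
    funext i
    exact (hv i).symm
  have hC : (C.card : ℂ) ≠ 0 := by
    have : g ∈ C := by simp [C, κ]
    exact_mod_cast (Finset.card_pos.mpr ⟨g, this⟩).ne'
  rw [← inv_smul_smul₀ hC (symState a n (Pi.single g 1)), ← h1]
  exact Submodule.smul_mem _ _ (Submodule.subset_span ⟨_, rfl⟩)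

end Spans

/-! ### Density -/

section Density

/-- A neighbourhood in the product topology constrains only finitely many coordinates. -/
theorem mem_closure_of_forall_finset {I : Type*} {K : Set (I → ℂ)} {x : I → ℂ}
    (h : ∀ F : Finset I, ∃ z ∈ K, ∀ b ∈ F, x b = z b) : x ∈ closure K := by
  classical
  choose z hz hxz using h
  refine mem_closure_of_tendsto (f := z) (b := Filter.atTop) ?_ (Filter.Eventually.of_forall hz)
  rw [tendsto_pi_nhds]
  intro b
  refine tendsto_const_nhds.congr' ?_
  filter_upwards [Filter.eventually_ge_atTop {b}] with F hF
  exact hxz F b (hF (Finset.mem_singleton_self b))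

/-- On finitely many coordinates, the closure of a span is the image of a projection. -/
theorem exists_finite_projection {S B : Type*} (a : B → S → ℂ) (F : Finset S) :
    ∃ w : F → S → ℂ, (∀ s, w s ∈ Submodule.span ℂ (Set.range a)) ∧
      ∀ v ∈ closure (Submodule.span ℂ (Set.range a) : Set (S → ℂ)),
        ∀ t : F, v t = ∑ s : F, v s * w s t := by
  classical
  let ρ : (S → ℂ) →ₗ[ℂ] (F → ℂ) := LinearMap.funLeft ℂ ℂ Subtype.val
  have hρ : Continuous ρ := continuous_pi fun t => continuous_apply (t : S)
  let V : Submodule ℂ (F → ℂ) := (Submodule.span ℂ (Set.range a)).map ρ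
  -- Restricted to `F` the span is finite-dimensional, hence closed: taking the closure adds nothing
  -- there.
  have hV : IsClosed (V : Set (F → ℂ)) := V.closed_of_finiteDimensional
  obtain ⟨π, hπ⟩ := V.subtype.exists_leftInverse_of_injective V.ker_subtype
  -- The `w s` lift the columns of a projection onto the restricted span to actual combinations of
  -- the `a i`.
  have hw : ∀ s : F, ∃ w ∈ Submodule.span ℂ (Set.range a), ρ w = π (Pi.single s 1) := fun s =>
    (π (Pi.single s 1)).2
  choose w hw1 hw2 using hw
  refine ⟨w, hw1, fun v hv t => ?_⟩
  have hvV : ρ v ∈ V := hV.closure_subset (map_mem_closure hρ hv fun y hy => ⟨y, hy, rfl⟩)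
  have h1 : (π (ρ v) : F → ℂ) = ρ v := congrArg Subtype.val (LinearMap.congr_fun hπ ⟨ρ v, hvV⟩)
  have h2 : ρ v = ∑ s : F, v s • Pi.single (M := fun _ => ℂ) s (1 : ℂ) := by
    funext t
    simp [ρ, LinearMap.funLeft, Finset.sum_apply, Pi.single_apply]
  rw [h2] at h1
  simp only [map_sum, map_smul, Submodule.coe_sum, Submodule.coe_smul, ← hw2] at h1
  rw [← h2] at h1
  have h3 := congrFun h1 t
  simp only [Finset.sum_apply, Pi.smul_apply, smul_eq_mul] at h3
  exact h3.symm

/-- A function that can be expanded in every one of its slots can be expanded in all of them. -/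
theorem multislot_expansion {S : Type*} {F : Finset S} {V : Set (S → ℂ)} {w : F → S → ℂ}
    (hw : ∀ v ∈ V, ∀ t : F, v t = ∑ s : F, v s * w s t) {ι : Type*} [Fintype ι] [DecidableEq ι]
    (y : (ι → S) → ℂ) (hy : ∀ c s, (fun t => y (Function.update s c t)) ∈ V) (t : ι → F) :
    y (fun c => t c) = ∑ s : ι → F, y (fun c => s c) * ∏ c, w (s c) (t c) := by
  have key : ∀ (n : ℕ) (y : (Fin n → S) → ℂ),
      (∀ c s, (fun t => y (Function.update s c t)) ∈ V) → ∀ t : Fin n → F,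
      y (fun c => t c) = ∑ s : Fin n → F, y (fun c => s c) * ∏ c, w (s c) (t c) := by
    intro n
    induction n with
    | zero =>
      intro y _ t
      simp only [Finset.univ_unique, Finset.sum_singleton, Finset.univ_eq_empty,
        Finset.prod_empty, mul_one]
      congr 1
      exact Subsingleton.elim _ _
    | succ n ih =>
      intro y hy t
      let e : F × (Fin n → F) ≃ (Fin (n + 1) → F) := Fin.consEquiv fun _ => F
      rw [← e.sum_comp, Fintype.sum_prod_type]
      -- Expand slot `0` with the other slots frozen; the remaining slots are left to the induction
      -- hypothesis.
      have h0 := hw _ (hy 0 fun c => t c) (t 0)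
      have hcons : ∀ x : F, Function.update (fun c => (t c : S)) 0 (x : S) =
          fun c => ((Fin.cons x (Fin.tail t) : Fin (n + 1) → F) c : S) := fun x => by
        funext c
        refine Fin.cases ?_ (fun c => ?_) c
        · simp
        · simp [Fin.tail]
      simp only [hcons] at h0
      rw [Fin.cons_self_tail] at h0
      rw [h0]
      refine Finset.sum_congr rfl fun x _ => ?_
      have h1 := ih (fun r => y (Fin.cons (x : S) r)) (fun c s => by
        have := hy c.succ (Fin.cons (x : S) s)
        simpa only [← Fin.cons_update] using this) (Fin.tail t)
      have hc : ∀ r : Fin n → F, (fun c => ((Fin.cons x r : Fin (n + 1) → F) c : S)) =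
          Fin.cons (x : S) fun c => (r c : S) := fun r => by
        funext c
        refine Fin.cases ?_ (fun c => ?_) c <;> simp
      rw [hc, h1, Finset.sum_mul]
      refine Finset.sum_congr rfl fun r _ => ?_
      simp only [e, Fin.consEquiv, Equiv.coe_fn_mk, Fin.prod_univ_succ, hc, Fin.cons_zero,
        Fin.cons_succ, Fin.tail]
      ring
  let e := Fintype.equivFin ι
  have h := key _ (fun r => y (r ∘ e)) (fun c s => by
    have := hy (e.symm c) (s ∘ e)
    simpa only [Function.update_comp_equiv] using this) (t ∘ e.symm)
  have hcomp : ((fun c => ((t ∘ e.symm) c : S)) ∘ e) = fun c => (t c : S) := by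
    funext c; simp
  simp only [hcomp] at h
  rw [h, ← (Equiv.arrowCongr e (Equiv.refl F)).sum_comp]
  refine Finset.sum_congr rfl fun s _ => ?_
  congr 1
  · congr 1
    funext c
    simp [Equiv.arrowCongr]
  · rw [← e.prod_comp]
    simp [Equiv.arrowCongr]

/-- Conditions on single slots are thereby converted into products of seed boundary states, exactly
on any finite set of coordinates. -/
theorem exists_product_approx {S B : Type*} (a : B → S → ℂ) (F : Finset S) {ι : Type*} [Fintype ι]
    [DecidableEq ι] (y : (ι → S) → ℂ)
    (hy : ∀ c s, (fun t => y (Function.update s c t)) ∈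
      closure (Submodule.span ℂ (Set.range a) : Set (S → ℂ))) :
    ∃ z ∈ Submodule.span ℂ (Set.range fun (f : ι → B) (s : ι → S) => ∏ c, a (f c) (s c)),
      ∀ t : ι → S, (∀ c, t c ∈ F) → y t = z t := by
  obtain ⟨w, hw1, hw2⟩ := exists_finite_projection a F
  refine ⟨∑ s : ι → F, y (fun c => s c) • fun t : ι → S => ∏ c, w (s c) (t c),
    Submodule.sum_mem _ fun s _ => Submodule.smul_mem _ _
      (prod_mem_span (fun _ => a) (fun c => w (s c)) fun c => hw1 _), fun t ht => ?_⟩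
  have h := multislot_expansion hw2 y hy fun c => ⟨t c, ht c⟩
  simpa [Finset.sum_apply] using h

variable {S : Type*} (T : SeedCFT S) {B : Type*} {a : B → S → ℂ} {N : ℕ}

open Classical in
/-- The inclusion of a sector. -/
def sectorIncl (p : Equiv.Perm (Fin N)) : ((Cycles p → S) → ℂ) →ₗ[ℂ] (OrbBasis S N → ℂ) where
  toFun y b := if h : b.1 = p then y (h ▸ b.2) else 0
  map_add' x y := by
    funext b
    by_cases h : b.1 = p <;> simp [h]
  map_smul' r x := by
    funext b
    by_cases h : b.1 = p <;> simp [h]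

theorem sectorIncl_self (p : Equiv.Perm (Fin N)) (y : (Cycles p → S) → ℂ) (s : Cycles p → S) :
    sectorIncl p y ⟨p, s⟩ = y s := by
  simp [sectorIncl]

theorem sectorIncl_of_ne {p q : Equiv.Perm (Fin N)} (h : q ≠ p) (y : (Cycles p → S) → ℂ)
    (s : Cycles q → S) : sectorIncl p y ⟨q, s⟩ = 0 := by
  simp [sectorIncl, h]

theorem sectorIncl_prod (p : Equiv.Perm (Fin N)) (f : Cycles p → B) :
    sectorIncl p (fun s => ∏ c, a (f c) (s c)) = ket a (fun k => f (Cycles.of p k)) p := by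
  funext ⟨q, s⟩
  by_cases h : q = p
  · subst h
    rw [sectorIncl_self, ket_self]
    simp only [Cycles.of_base]
  · rw [sectorIncl_of_ne h, ket_of_ne _ h]

/-- The span of the states `⨂_c |(a_{f(c)})_c⟩` of all the sectors. -/
def ketSpan (a : B → S → ℂ) (N : ℕ) : Submodule ℂ (OrbBasis S N → ℂ) :=
  Submodule.span ℂ {x | ∃ (f : Fin N → B) (p : Equiv.Perm (Fin N)),
    (∀ k, f (p k) = f k) ∧ ket a f p = x}

theorem mem_closure_ketSpan {x : OrbBasis S N → ℂ}
    (hx : ∀ (p : Equiv.Perm (Fin N)) (c : Cycles p) (s : Cycles p → S),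
      (fun t => x ⟨p, Function.update s c t⟩) ∈
        closure (Submodule.span ℂ (Set.range a) : Set (S → ℂ))) :
    x ∈ closure (ketSpan a N : Set (OrbBasis S N → ℂ)) := by
  classical
  refine mem_closure_of_forall_finset fun F => ?_
  -- The finitely many seed states that occur in some slot of some element of `F`.
  let F₀ : Finset S := F.biUnion fun b => Finset.univ.image b.2
  choose z hz hxz using fun p : Equiv.Perm (Fin N) =>
    exists_product_approx a F₀ (fun s : Cycles p → S => x ⟨p, s⟩) (hx p)
  refine ⟨∑ p, sectorIncl p (z p), Submodule.sum_mem _ fun p _ => ?_, ?_⟩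
  · have h1 := Submodule.mem_map_of_mem (f := sectorIncl p) (hz p)
    rw [Submodule.map_span, ← Set.range_comp] at h1
    refine Submodule.span_mono ?_ h1
    rintro _ ⟨f, rfl⟩
    exact ⟨_, p, fun k => by simp only [Cycles.of_apply], (sectorIncl_prod p f).symm⟩
  · rintro ⟨p, s⟩ hb
    rw [Finset.sum_apply, Finset.sum_eq_single p, sectorIncl_self]
    · refine hxz p s fun c => ?_
      exact Finset.mem_biUnion.mpr ⟨_, hb, Finset.mem_image_of_mem _ (Finset.mem_univ c)⟩
    · intro q _ hq
      exact sectorIncl_of_ne hq.symm _ _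
    · simp

/-- Averaging over the permutations of the copies. -/
def permAverage (N : ℕ) : (OrbBasis S N → ℂ) →ₗ[ℂ] (OrbBasis S N → ℂ) :=
  (N.factorial : ℂ)⁻¹ • ∑ u : Equiv.Perm (Fin N), T.permAct u

theorem continuous_permAct (u : Equiv.Perm (Fin N)) : Continuous (T.permAct u) :=
  continuous_pi fun _ => continuous_const.mul (continuous_apply _)

theorem continuous_permAverage : Continuous (permAverage T N) := by
  have : (permAverage T N : (OrbBasis S N → ℂ) → (OrbBasis S N → ℂ)) = fun x =>
      (N.factorial : ℂ)⁻¹ • ∑ u : Equiv.Perm (Fin N), T.permAct u x := by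
    funext x
    simp [permAverage]
  rw [this]
  exact Continuous.const_smul (continuous_finsetSum _ fun u _ => continuous_permAct T u)
    (N.factorial : ℂ)⁻¹

theorem permAverage_of_invariant {x : OrbBasis S N → ℂ} (hx : ∀ u, T.permAct u x = x) :
    permAverage T N x = x := by
  have hN : (N.factorial : ℂ) ≠ 0 := by exact_mod_cast N.factorial_ne_zero
  simp only [permAverage, LinearMap.smul_apply, LinearMap.sum_apply, hx, Finset.sum_const,
    Finset.card_univ, Fintype.card_perm, Fintype.card_fin]
  rw [← Nat.cast_smul_eq_nsmul ℂ, inv_smul_smul₀ hN]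

variable [LinearOrder B]

/-- Sorting the copies by label conjugates `p` into a Young subgroup; the orbit average of the ket
is then the symmetrization of a single block permutation. -/
theorem permAverage_mem (ha : ∀ i, a i ∈ T.ishibashiSpace) {x : OrbBasis S N → ℂ}
    (hx : x ∈ ketSpan a N) : permAverage T N x ∈
      Submodule.span ℂ (Set.range fun l : CardyLabel B N => cardyState a l) := by
  classical
  rw [← Submodule.mem_comap]
  refine Submodule.span_le.mpr ?_ hx
  rintro _ ⟨f, p, hf, rfl⟩
  obtain ⟨n, h₀, hn⟩ := exists_color f
  obtain ⟨g, hg⟩ := exists_blockPerm n (h₀⁻¹ * p * h₀) fun k => by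
    rw [← hn, ← hn]
    simp [hf]
  have hp : p = h₀ * blockPerm n g * h₀⁻¹ := by rw [hg]; group
  have hf' : ∀ k, f k = color n (h₀⁻¹ k) := fun k => by rw [← hn]; simp
  have h1 : permAverage T N (ket a f p) =
      (N.factorial : ℂ)⁻¹ • symState a n (Pi.single g 1) := by
    rw [symState_single]
    conv_rhs => rw [← Equiv.sum_comp (Equiv.mulRight h₀)]
    simp only [permAverage, LinearMap.smul_apply, LinearMap.sum_apply]
    congr 1
    refine Finset.sum_congr rfl fun u _ => ?_
    rw [permAct_ket T ha u f p hf, hp]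
    simp [hf', mul_assoc]
  rw [SetLike.mem_coe, Submodule.mem_comap]
  rw [h1]
  exact Submodule.smul_mem _ _ (symState_single_mem n g)

/-- Averaging over `S_N` is continuous, fixes the symmetry class and sends kets to combinations of
Cardy states, so approximation by kets suffices. -/
theorem closure_span_cardyState (ha : ∀ i, a i ∈ T.ishibashiSpace)
    (hdense : closure (Submodule.span ℂ (Set.range a) : Set (S → ℂ)) = T.ishibashiSpace) :
    closure (Submodule.span ℂ (Set.range fun l : CardyLabel B N => cardyState a l) :
      Set (OrbBasis S N → ℂ)) = T.symmetryClass N := by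
  apply Set.Subset.antisymm
  · have hclosed : IsClosed (T.symmetryClass N : Set (OrbBasis S N → ℂ)) := by
      -- Closedness is inherited from the density hypothesis, which exhibits the Ishibashi space as
      -- a closure.
      have hI : IsClosed (T.ishibashiSpace : Set (S → ℂ)) := hdense ▸ isClosed_closure
      have : (T.symmetryClass N : Set (OrbBasis S N → ℂ)) =
          (⋂ u, {x | T.permAct u x = x}) ∩
            ⋂ (p : Equiv.Perm (Fin N)) (c : Cycles p) (s : Cycles p → S),
              {x | (fun t => x ⟨p, Function.update s c t⟩) ∈ (T.ishibashiSpace : Set (S → ℂ))} := by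
        ext x
        simp only [SetLike.mem_coe, mem_symmetryClass, Set.mem_inter_iff, Set.mem_iInter]
        rfl
      rw [this]
      refine (isClosed_iInter fun u => isClosed_eq (continuous_permAct T u) continuous_id).inter
        (isClosed_iInter fun p => isClosed_iInter fun c => isClosed_iInter fun s => ?_)
      exact hI.preimage (continuous_pi fun t => continuous_apply _)
    refine closure_minimal (Submodule.span_le.mpr ?_) hclosed
    rintro _ ⟨l, rfl⟩
    exact cardyState_mem T ha l
  · intro x hx
    obtain ⟨hinv, hslot⟩ := (mem_symmetryClass T).mp hx
    have h1 : x ∈ closure (ketSpan a N : Set (OrbBasis S N → ℂ)) :=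
      mem_closure_ketSpan fun p c s => by rw [hdense]; exact hslot p c s
    rw [← permAverage_of_invariant T hinv]
    exact map_mem_closure (continuous_permAverage T) h1 fun y hy => permAverage_mem T ha hy

omit [LinearOrder B] in
theorem finite_mult [Finite B] : Finite (Mult B N) := by
  have hle : ∀ (n : Mult B N) i, n.1 i < N + 1 := fun n i => by
    by_cases hi : i ∈ n.1.support
    · refine Nat.lt_succ_of_le (le_trans ?_ n.2.le)
      exact Finset.single_le_sum (f := fun i => n.1 i) (fun _ _ => Nat.zero_le _) hi
    · rw [Finsupp.notMem_support_iff.mp hi]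
      exact N.succ_pos
  refine Finite.of_injective (fun (n : Mult B N) (i : B) => (⟨n.1 i, hle n i⟩ : Fin (N + 1))) ?_
  intro n n' h
  apply Subtype.ext
  ext i
  exact congrArg Fin.val (congrFun h i)

/-- For finite `B` there are finitely many labels, so the span is finite-dimensional and equals its
closure, the whole symmetry class. -/
theorem isCompleteIn_symmetryClass [Finite B] (ha : ∀ i, a i ∈ T.ishibashiSpace)
    (hCardy : IsCardyFamily T.c T.dim a)
    (hdense : closure (Submodule.span ℂ (Set.range a) : Set (S → ℂ)) = T.ishibashiSpace) :
    IsCompleteIn (N * T.c) (T.orbDim N) (fun l : CardyLabel B N => cardyState a l)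
      (T.symmetryClass N) := by
  refine (isCardyFamily_cardyState T hCardy).isCompleteIn ?_
  have := finite_mult (B := B) (N := N)
  have hfd : FiniteDimensional ℂ
      (Submodule.span ℂ (Set.range fun l : CardyLabel B N => cardyState a l)) :=
    FiniteDimensional.span_of_finite ℂ (Set.finite_range _)
  have hclosed := (Submodule.span ℂ (Set.range fun l : CardyLabel B N =>
    cardyState a l)).closed_of_finiteDimensional
  apply SetLike.coe_injective
  rw [← closure_span_cardyState T ha hdense, hclosed.closure_eq]

end Density

end SymOrb

end

theorem claim3p1 {S : Type*} (T : SymOrb.SeedCFT S)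
    {B : Type*} [LinearOrder B] (a : B → S → ℂ)
    (ha : ∀ i, a i ∈ T.ishibashiSpace)
    (hCardy : SymOrb.IsCardyFamily T.c T.dim a) (N : ℕ) :
    -- the states are states of the orbifold in the symmetry class
    (∀ l : SymOrb.CardyLabel B N, SymOrb.cardyState a l ∈ T.symmetryClass N) ∧
    -- they satisfy Cardy's condition
    SymOrb.IsCardyFamily (N * T.c) (T.orbDim N)
      (fun l : SymOrb.CardyLabel B N => SymOrb.cardyState a l) ∧
    -- for every multiplicity vector, there are as many of them as Ishibashi states, with equal span
    (∀ n : SymOrb.Mult B N,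
      Nonempty (((i : n.1.support) → SymOrb.Irrep (Equiv.Perm (Fin (n.1 i)))) ≃
        ((i : n.1.support) → ConjClasses (Equiv.Perm (Fin (n.1 i))))) ∧
      Submodule.span ℂ (Set.range fun r => SymOrb.cardyState a (N := N) ⟨n, r⟩) =
        Submodule.span ℂ (Set.range fun κ => SymOrb.ishibashiState a (N := N) ⟨n, κ⟩)) ∧
    -- the Ishibashi states are independent states of the symmetry class, and the Cardy states are
    -- complete in their span
    (∀ l : SymOrb.IshibashiLabel B N, SymOrb.ishibashiState a l ∈ T.symmetryClass N) ∧
    LinearIndependent ℂ (fun l : SymOrb.IshibashiLabel B N => SymOrb.ishibashiState a l) ∧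
    SymOrb.IsCompleteIn (N * T.c) (T.orbDim N)
      (fun l : SymOrb.CardyLabel B N => SymOrb.cardyState a l)
      (Submodule.span ℂ
        (Set.range fun l : SymOrb.IshibashiLabel B N => SymOrb.ishibashiState a l)) ∧
    -- if the seed boundary states are complete, the Cardy states are complete in the symmetry class
    (closure (Submodule.span ℂ (Set.range a) : Set (S → ℂ)) = T.ishibashiSpace →
      closure (Submodule.span ℂ (Set.range fun l : SymOrb.CardyLabel B N =>
          SymOrb.cardyState a l) : Set (SymOrb.OrbBasis S N → ℂ)) = T.symmetryClass N ∧
      (Finite B → SymOrb.IsCompleteIn (N * T.c) (T.orbDim N)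
        (fun l : SymOrb.CardyLabel B N => SymOrb.cardyState a l) (T.symmetryClass N))) :=
  ⟨SymOrb.cardyState_mem T ha, SymOrb.isCardyFamily_cardyState T hCardy,
    fun n => ⟨SymOrb.nonempty_label_equiv n, SymOrb.span_cardyState_eq n⟩,
    SymOrb.ishibashiState_mem T ha,
    SymOrb.linearIndependent_ishibashiState
      (SymOrb.isCardyFamily_cardyState T hCardy).linearIndependent,
    (SymOrb.isCardyFamily_cardyState T hCardy).isCompleteIn SymOrb.span_cardyState_eq_ishibashi,
    fun hdense => ⟨SymOrb.closure_span_cardyState T ha hdense,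
      fun _ => SymOrb.isCompleteIn_symmetryClass T ha hCardy hdense⟩⟩
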